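/- Let $\Bbbk$ be a field of characteristic $p>2$ with algebraic closure $\overline{\Bbbk}$. A Hopf superalgebra is a Hopf algebra object in the symmetric tensor category of super-vector spaces ($\mathbb{Z}/2$-graded vector spaces with symmetry $v\otimes w\mapsto(-1)^{|v||w|}w\otimes v$); it is purely even if its odd part is $0$. Let $H$ be a finite-dimensional Hopf superalgebra over $\Bbbk$ which is irreducible, i.e. its coradical (the sum of all simple subcoalgebras of $H$) is $\Bbbk 1$. Let $P(H)=\{u\in H\mid\Delta(u)=1\otimes u+u\otimes 1\}$ be the Lie superalgebra of primitive elements of $H$, with bracket $[u,v]=uv-(-1)^{|u||v|}vu$ for homogeneous $u,v$. Then the following are equivalent: (i) $H$ is semisimple as an algebra; (ii) $H$ is purely even, and is commutative and semisimple as an algebra; (iii) the base extension $H\otimes_{\Bbbk}\overline{\Bbbk}$ is isomorphic, as a Hopf superalgebra over $\overline{\Bbbk}$, to the (purely even) function algebra $\overline{\Bbbk}^G$ of some finite $p$-group $G$, where $\overline{\Bbbk}^G$ has pointwise multiplication, $\Delta(f)(a,b)=f(ab)$ and $\varepsilon(f)=f(1)$; (iv) $P(H)$ is purely even and is a torus,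 in the sense that $P(H)$ is abelian as a Lie algebra and, for every $u\in P(H)$, the (unital) subalgebra of $H$ generated by $u$ is semisimple. -/

import Mathlib

open scoped TensorProduct

/-- The degree `n` part `⨁_{i + j = n} A_i ⊗ A_j` of the tensor square of a super-vector space
`A = A_0 ⊕ A_1`. -/
def superTensorGrading {k A : Type*} [Field k] [AddCommGroup A] [Module k A]
    (𝒜 : ZMod 2 → Submodule k A) (n : ZMod 2) : Submodule k (A ⊗[k] A) :=
  ⨆ i : ZMod 2, LinearMap.range (TensorProduct.map (𝒜 i).subtype (𝒜 (n - i)).subtype)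

/-- A Hopf superalgebra over `k`, i.e. a Hopf algebra object in super-vector spaces over `k`.
The superalgebra `A = 𝒜 0 ⊕ 𝒜 1` and the (coassociative, counital) coalgebra structure are
parameters; the fields say that all structure maps preserve parity, that `Δ` and `ε` are
algebra maps, where `A ⊗ A` carries the product
`(a ⊗ b)(c ⊗ d) = (-1)^{|b||c|} ac ⊗ bd` (this is Mathlib's `𝒜 ᵍ⊗[k] 𝒜`),
and that there is an antipode. -/
class HopfSuperalgebra (k : Type*) {A : Type*} [Field k] [Ring A] [Algebra k A]
    (𝒜 : ZMod 2 → Submodule k A) [GradedAlgebra 𝒜] [Coalgebra k A] where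
  comul_mem : ∀ (n : ZMod 2), ∀ a ∈ 𝒜 n,
    (Coalgebra.comul a : A ⊗[k] A) ∈ superTensorGrading 𝒜 n
  counit_odd : ∀ a ∈ 𝒜 1, (Coalgebra.counit a : k) = 0
  comul_one : (Coalgebra.comul (1 : A) : A ⊗[k] A) = 1 ⊗ₜ[k] 1
  comul_mul : ∀ a b : A,
    GradedTensorProduct.of k 𝒜 𝒜 (Coalgebra.comul (a * b)) =
      GradedTensorProduct.of k 𝒜 𝒜 (Coalgebra.comul a) *
        GradedTensorProduct.of k 𝒜 𝒜 (Coalgebra.comul b)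
  counit_one : (Coalgebra.counit (1 : A) : k) = 1
  counit_mul : ∀ a b : A,
    (Coalgebra.counit (a * b) : k) = Coalgebra.counit a * Coalgebra.counit b
  antipode : A →ₗ[k] A
  antipode_mem : ∀ (n : ZMod 2), ∀ a ∈ 𝒜 n, antipode a ∈ 𝒜 n
  mul_antipode_rTensor_comul :
    LinearMap.mul' k A ∘ₗ antipode.rTensor A ∘ₗ Coalgebra.comul =
      Algebra.linearMap k A ∘ₗ Coalgebra.counit
  mul_antipode_lTensor_comul :
    LinearMap.mul' k A ∘ₗ antipode.lTensor A ∘ₗ Coalgebra.comul =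
      Algebra.linearMap k A ∘ₗ Coalgebra.counit

/-- A super-vector space is purely even if it equals its even part. -/
def IsPurelyEven {k A : Type*} [Field k] [AddCommGroup A] [Module k A]
    (𝒜 : ZMod 2 → Submodule k A) : Prop :=
  𝒜 0 = ⊤

section Coradical

variable (k : Type*) {C : Type*} [Field k] [AddCommGroup C] [Module k C] [Coalgebra k C]

/-- A subspace `D` of a coalgebra is a subcoalgebra if `Δ(D) ⊆ D ⊗ D`. -/
def IsSubcoalgebra (D : Submodule k C) : Prop :=
  ∀ c ∈ D, (Coalgebra.comul c : C ⊗[k] C) ∈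
    LinearMap.range (TensorProduct.map D.subtype D.subtype)

/-- A simple subcoalgebra: nonzero, and without proper nonzero subcoalgebras. -/
def IsSimpleSubcoalgebra (D : Submodule k C) : Prop :=
  IsSubcoalgebra k D ∧ D ≠ ⊥ ∧ ∀ E : Submodule k C, IsSubcoalgebra k E → E ≤ D → E = ⊥ ∨ E = D

variable (C) in
/-- The coradical: the sum of all simple subcoalgebras. -/
def coradical : Submodule k C :=
  sSup {D : Submodule k C | IsSimpleSubcoalgebra k D}

end Coradical

/-- `A` is irreducible if its coradical is `k = k·1`. -/
def IsIrreducibleHopf (k A : Type*) [Field k] [Ring A] [Algebra k A] [Coalgebra k A] : Prop :=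
  coradical k A = Submodule.span k {(1 : A)}

/-- The space `P(A)` of primitive elements: `Δ(u) = 1 ⊗ u + u ⊗ 1`. -/
def primitives (k A : Type*) [Field k] [Ring A] [Algebra k A] [Coalgebra k A] :
    Submodule k A where
  carrier := {u | (Coalgebra.comul u : A ⊗[k] A) = 1 ⊗ₜ[k] u + u ⊗ₜ[k] 1}
  zero_mem' := by simp
  add_mem' {a b} ha hb := by
    simp only [Set.mem_ofPred_eq] at ha hb ⊢
    rw [map_add, ha, hb, TensorProduct.tmul_add, TensorProduct.add_tmul]
    abel
  smul_mem' c a ha := by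
    simp only [Set.mem_ofPred_eq] at ha ⊢
    rw [map_smul, ha, smul_add, TensorProduct.tmul_smul c 1 a, TensorProduct.smul_tmul' c a 1]

/-- The super-commutator, the bilinear extension of `[u, v] = uv - (-1)^{|u||v|} vu`. -/
noncomputable def superCommutator {k A : Type*} [Field k] [Ring A] [Algebra k A]
    (𝒜 : ZMod 2 → Submodule k A) [GradedAlgebra 𝒜] (u v : A) : A :=
  ∑ i : ZMod 2, ∑ j : ZMod 2,
    ((DirectSum.decompose 𝒜 u i : A) * (DirectSum.decompose 𝒜 v j : A) -
      ((-1 : ℤˣ) ^ (i * j)) • ((DirectSum.decompose 𝒜 v j : A) * (DirectSum.decompose 𝒜 u i : A)))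

/-- `P(A)` is a torus: its bracket vanishes, and each of its elements generates a
semisimple subalgebra of `A`. -/
def PrimitivesIsTorus {k A : Type*} [Field k] [Ring A] [Algebra k A]
    (𝒜 : ZMod 2 → Submodule k A) [GradedAlgebra 𝒜] [Coalgebra k A] : Prop :=
  (∀ u ∈ primitives k A, ∀ v ∈ primitives k A, superCommutator 𝒜 u v = 0) ∧
    ∀ u ∈ primitives k A, IsSemisimpleRing (Algebra.adjoin k {u})

/-- An isomorphism of Hopf superalgebras: a bijective parity-preserving algebra and coalgebra
map (such a map automatically commutes with the antipodes). -/
structure HopfSuperalgebraEquiv {k A B : Type*} [Field k] [Ring A] [Algebra k A] [Coalgebra k A]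
    [Ring B] [Algebra k B] [Coalgebra k B]
    (𝒜 : ZMod 2 → Submodule k A) (ℬ : ZMod 2 → Submodule k B) extends A ≃ₐ[k] B where
  map_mem : ∀ (i : ZMod 2), ∀ a ∈ 𝒜 i, toFun a ∈ ℬ i
  map_counit : ∀ a : A, (Coalgebra.counit (toFun a) : k) = Coalgebra.counit a
  map_comul : ∀ a : A, (Coalgebra.comul (toFun a) : B ⊗[k] B) =
    TensorProduct.map toAlgEquiv.toLinearMap toAlgEquiv.toLinearMap (Coalgebra.comul a)

/-- The algebra `k^G` of all functions `G → k` with pointwise operations. It is a type synonym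
of `G → k`, because the latter carries a different (pointwise) coalgebra structure in Mathlib. -/
def FunctionAlgebra (k G : Type*) : Type _ := G → k

namespace FunctionAlgebra

noncomputable section

variable (k G : Type*) [Field k]

instance : CommRing (FunctionAlgebra k G) := inferInstanceAs (CommRing (G → k))

instance : Algebra k (FunctionAlgebra k G) := inferInstanceAs (Algebra k (G → k))

variable {G}

open Classical in
/-- The indicator function `δ_a` of `a ∈ G`. -/
def delta (a : G) : FunctionAlgebra k G := (Pi.single a (1 : k) : G → k)

/-- Evaluation at `a ∈ G`, as a linear map. -/
def evalAt (a : G) : FunctionAlgebra k G →ₗ[k] k := (LinearMap.proj a : (G → k) →ₗ[k] k)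

@[simp] theorem evalAt_apply (a : G) (f : FunctionAlgebra k G) : evalAt k a f = f a := rfl

open Classical in
theorem delta_apply (a b : G) : delta k a b = if b = a then 1 else 0 := by
  simp [delta, Pi.single_apply]

theorem sum_apply_smul_delta [Fintype G] (f : FunctionAlgebra k G) :
    ∑ a : G, f a • delta k a = f := by
  classical
  refine funext fun b => ?_
  change evalAt k b (∑ a : G, f a • delta k a) = f b
  rw [map_sum, Finset.sum_eq_single b]
  · simp [delta_apply]
  · intro a _ hab
    simp [delta_apply, hab.symm]
  · simp

variable [Group G] [Fintype G]

/-- The coalgebra structure of `k^G`, dual to the group structure: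
`Δ(f) = ∑_{a,b} f(ab) δ_a ⊗ δ_b`, i.e. `Δ(f)(a, b) = f(ab)`, and `ε(f) = f(1)`. -/
instance : CoalgebraStruct k (FunctionAlgebra k G) where
  comul := ∑ a : G, ∑ b : G, (evalAt k (a * b)).smulRight (delta k a ⊗ₜ[k] delta k b)
  counit := evalAt k 1

theorem counit_apply (f : FunctionAlgebra k G) : (Coalgebra.counit f : k) = f 1 := rfl

theorem comul_apply (f : FunctionAlgebra k G) :
    (Coalgebra.comul f : FunctionAlgebra k G ⊗[k] FunctionAlgebra k G) =
      ∑ a : G, ∑ b : G, f (a * b) • (delta k a ⊗ₜ[k] delta k b) := by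
  simp [CoalgebraStruct.comul]

theorem comul_delta_left (x : G) :
    (Coalgebra.comul (delta k x) : FunctionAlgebra k G ⊗[k] FunctionAlgebra k G) =
      ∑ b : G, delta k (x * b⁻¹) ⊗ₜ[k] delta k b := by
  classical
  rw [comul_apply, Finset.sum_comm]
  refine Finset.sum_congr rfl fun b _ => ?_
  rw [Finset.sum_eq_single (x * b⁻¹)]
  · simp [delta_apply]
  · intro a _ ha
    rw [delta_apply, if_neg, zero_smul]
    rintro rfl
    simp at ha
  · simp

theorem comul_delta_right (x : G) :
    (Coalgebra.comul (delta k x) : FunctionAlgebra k G ⊗[k] FunctionAlgebra k G) =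
      ∑ a : G, delta k a ⊗ₜ[k] delta k (a⁻¹ * x) := by
  classical
  rw [comul_apply]
  refine Finset.sum_congr rfl fun a _ => ?_
  rw [Finset.sum_eq_single (a⁻¹ * x)]
  · simp [delta_apply]
  · intro b _ hb
    rw [delta_apply, if_neg, zero_smul]
    rintro rfl
    simp at hb
  · simp

instance : Coalgebra k (FunctionAlgebra k G) where
  coassoc := by
    refine LinearMap.ext fun f => ?_
    simp only [LinearMap.comp_apply, LinearEquiv.coe_coe]
    rw [comul_apply]
    simp only [map_sum, map_smul, LinearMap.rTensor_tmul, LinearMap.lTensor_tmul]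
    have h1 : ∀ x c : G, f (x * c) • TensorProduct.assoc k _ _ _
        (Coalgebra.comul (R := k) (delta k x) ⊗ₜ[k] delta k c) =
        ∑ b : G, f (x * c) • (delta k (x * b⁻¹) ⊗ₜ[k] (delta k b ⊗ₜ[k] delta k c)) := by
      intro x c
      simp only [comul_delta_left, TensorProduct.sum_tmul, map_sum, Finset.smul_sum,
        TensorProduct.assoc_tmul]
    have h2 : ∀ a y : G, f (a * y) •
        (delta k a ⊗ₜ[k] Coalgebra.comul (R := k) (delta k y)) =
        ∑ b : G, f (a * y) • (delta k a ⊗ₜ[k] (delta k b ⊗ₜ[k] delta k (b⁻¹ * y))) := by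
      intro a y
      simp only [comul_delta_right, TensorProduct.tmul_sum, Finset.smul_sum]
    simp only [h1, h2]
    have h3 : ∀ b c : G,
        ∑ x : G, f (x * c) • (delta k (x * b⁻¹) ⊗ₜ[k] (delta k b ⊗ₜ[k] delta k c)) =
        ∑ a : G, f (a * b * c) • (delta k a ⊗ₜ[k] (delta k b ⊗ₜ[k] delta k c)) := by
      intro b c
      rw [← Equiv.sum_comp (Equiv.mulRight b)]
      simp
    have h4 : ∀ a b : G,
        ∑ y : G, f (a * y) • (delta k a ⊗ₜ[k] (delta k b ⊗ₜ[k] delta k (b⁻¹ * y))) =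
        ∑ c : G, f (a * b * c) • (delta k a ⊗ₜ[k] (delta k b ⊗ₜ[k] delta k c)) := by
      intro a b
      rw [← Equiv.sum_comp (Equiv.mulLeft b)]
      simp [mul_assoc]
    calc _ = ∑ c : G, ∑ b : G, ∑ x : G,
          f (x * c) • (delta k (x * b⁻¹) ⊗ₜ[k] (delta k b ⊗ₜ[k] delta k c)) := by
            rw [Finset.sum_comm]
            refine Finset.sum_congr rfl fun c _ => ?_
            rw [Finset.sum_comm]
      _ = ∑ c : G, ∑ b : G, ∑ a : G,
          f (a * b * c) • (delta k a ⊗ₜ[k] (delta k b ⊗ₜ[k] delta k c)) := by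
            simp only [h3]
      _ = ∑ a : G, ∑ b : G, ∑ c : G,
          f (a * b * c) • (delta k a ⊗ₜ[k] (delta k b ⊗ₜ[k] delta k c)) := by
            rw [Finset.sum_comm]
            conv_lhs => enter [2, b]; rw [Finset.sum_comm]
            rw [Finset.sum_comm]
      _ = ∑ a : G, ∑ b : G, ∑ y : G,
          f (a * y) • (delta k a ⊗ₜ[k] (delta k b ⊗ₜ[k] delta k (b⁻¹ * y))) := by
            simp only [h4]
      _ = _ := by
            refine Finset.sum_congr rfl fun a _ => ?_
            rw [Finset.sum_comm]
  rTensor_counit_comp_comul := by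
    classical
    refine LinearMap.ext fun f => ?_
    simp only [LinearMap.comp_apply, comul_apply, map_sum, map_smul, LinearMap.rTensor_tmul,
      counit_apply, delta_apply, TensorProduct.mk_apply]
    rw [Finset.sum_eq_single 1]
    · simp only [if_true, one_mul, ← TensorProduct.tmul_smul, ← TensorProduct.tmul_sum,
        sum_apply_smul_delta]
    · intro a _ ha
      simp [ha.symm]
    · simp
  lTensor_counit_comp_comul := by
    classical
    refine LinearMap.ext fun f => ?_
    simp only [LinearMap.comp_apply, comul_apply, map_sum, map_smul, LinearMap.lTensor_tmul,
      counit_apply, delta_apply, TensorProduct.mk_apply, LinearMap.flip_apply]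
    rw [Finset.sum_comm, Finset.sum_eq_single 1]
    · simp only [if_true, mul_one, TensorProduct.smul_tmul', ← TensorProduct.sum_tmul,
        sum_apply_smul_delta]
    · intro a _ ha
      simp [ha.symm]
    · simp

/-- `k^G` is regarded as a purely even superalgebra. -/
def grading (k G : Type*) [Field k] (i : ZMod 2) : Submodule k (FunctionAlgebra k G) :=
  if i = 0 then ⊤ else ⊥

end

end FunctionAlgebra

/-- The grading of the base extension `K ⊗ A`, with parts `K ⊗ A_i`. -/
def baseChangeGrading {k A : Type*} (K : Type*) [Field k] [Field K] [Algebra k K]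
    [AddCommGroup A] [Module k A] (𝒜 : ZMod 2 → Submodule k A) (i : ZMod 2) :
    Submodule K (K ⊗[k] A) :=
  (𝒜 i).baseChange K

/-!
The augmentation ideal of an irreducible `H` is exhausted by the filtration `F₁ ⊆ F₂ ⊆ ⋯` in which
`F₁ = P(H)` and `Fₙ₊₁` consists of the elements whose reduced comultiplication
`Δ(a) - 1 ⊗ a - a ⊗ 1` lies in `Fₙ ⊗ Fₙ` (`IsIrreducibleHopf.isConilpotent`). Statements about
primitive elements are thereby propagated to `H` by induction. If `P(H)` is even, then so is `H`
(`isPurelyEven_of_primitives_le`). For an ordinary bialgebra over a perfect field of characteristic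
`p` whose primitive elements commute and are not `p`-nilpotent, the Frobenius map is injective on
every `Fₙ` and surjective up to primitive elements, so that the bialgebra is commutative and
reduced (`commute_of_primitives`, `isReduced_of_primitives`). Over an algebraically closed field it
is then the function algebra of its group of characters, a `p`-group since `χ - ε` is nilpotent in the
dual algebra for every character `χ` (`exists_pGroup_functionAlgebra`).

It remains to obtain these properties of the primitive elements.

* If `H` is semisimple, it has a left integral `Λ` with `ε(Λ) = 1`. Left multiplication by a
  (possibly odd) primitive element `u` is dual to a skew derivation, and since `u Λ = 0`, this
  derivation cannot attain `1`. Hence `u² q = 0` implies `u q = 0` for `q` commuting with `u`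
  (`mul_eq_zero_of_mul_mul_eq_zero`). This rules out nonzero odd primitive elements
  (`eq_zero_of_odd_primitive`), and nilpotent ones over the algebraic closure, where the integral
  persists. Hochschild's theorem `commute_primitives_of_pow_char` then gives commutativity.
* If `P(H)` is a torus, the minimal polynomials of its elements are separable, because their
  derivatives are constant (`derivative_minpoly_of_mem_primitives`). So the elements of
  `P(H ⊗ K) = P(H) ⊗ K` act on `H ⊗ K` by commuting sums of semisimple endomorphisms, and no nonzero
  one is nilpotent.

The other implications are formal: `H` embeds into the function algebra `H ⊗ K`, and for
finite-dimensional commutative algebras semisimple means reduced.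
-/

/-! ### The radical of an algebra with a distinguished character -/

/-- If the kernel of a character `χ` of a finite-dimensional algebra contains every proper
two-sided ideal, then it is nilpotent: it is the Jacobson radical. -/
theorem isNilpotent_ker_of_forall_le {k R : Type*} [Field k] [Ring R] [Algebra k R]
    [FiniteDimensional k R] (χ : R →+* k)
    (h : ∀ M : Ideal R, M.IsTwoSided → M ≠ ⊤ → M ≤ RingHom.ker χ) :
    IsNilpotent (RingHom.ker χ) := by
  have : IsArtinianRing R := IsArtinianRing.of_finite k R
  have hnt : Nontrivial R := χ.domain_nontrivial
  have hJ : Ring.jacobson R ≤ RingHom.ker χ := h _ inferInstance (Ring.jacobson_lt_top R).ne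
  suffices hle : RingHom.ker χ ≤ Ring.jacobson R by
    rw [le_antisymm hle hJ]
    exact IsSemiprimaryRing.isNilpotent
  let q := Ideal.Quotient.mk (Ring.jacobson R)
  let χ' : R ⧸ Ring.jacobson R →+* k := Ideal.Quotient.lift _ χ fun a ha => hJ ha
  obtain ⟨C, hC⟩ := exists_isCompl (RingHom.ker χ')
  obtain ⟨e, he, c, hc, hec⟩ := Submodule.mem_sup.mp
    (hC.sup_eq_top ▸ Submodule.mem_top : (1 : R ⧸ Ring.jacobson R) ∈ RingHom.ker χ' ⊔ C)
  have hχc : χ' c = 1 := by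
    have := congrArg χ' hec
    rwa [map_add, (RingHom.mem_ker).mp he, zero_add, map_one] at this
  have hxc : ∀ x, χ' x = 0 → x * c = 0 := by
    intro x hx
    have h1 : x * c ∈ RingHom.ker χ' := by simp [RingHom.mem_ker, hx]
    exact Submodule.disjoint_def.mp hC.disjoint _ h1 (C.smul_mem x hc)
  -- the right annihilator of the image of `ker χ` is two-sided and not inside `ker χ`
  let X : Ideal R :=
    { carrier := {y | ∀ x, χ x = 0 → q (x * y) = 0}
      add_mem' := fun ha hb x hx => by rw [mul_add, map_add, ha x hx, hb x hx, add_zero]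
      zero_mem' := fun x _ => by simp
      smul_mem' := fun r y hy x hx => by
        rw [smul_eq_mul, ← mul_assoc]
        exact hy _ (by simp [hx]) }
  have hX : X.IsTwoSided := ⟨fun {a} b ha x hx => by rw [← mul_assoc, map_mul, ha x hx, zero_mul]⟩
  have hXtop : X = ⊤ := by
    by_contra hne
    obtain ⟨c', rfl⟩ := Ideal.Quotient.mk_surjective c
    have hmem : c' ∈ X := fun x hx => by
      rw [map_mul]
      exact hxc _ hx
    have h0 : χ c' = 0 := h X hX hne hmem
    have h1 : χ c' = 1 := hχc
    exact one_ne_zero (h1.symm.trans h0)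
  intro x hx
  have h1 : (1 : R) ∈ X := hXtop ▸ Submodule.mem_top
  have := h1 x hx
  rw [mul_one] at this
  exact Ideal.Quotient.eq_zero_iff_mem.mp this

/-! ### The tensor square of a subspace -/

section TensorSquare

variable {k V : Type*} [Field k] [AddCommGroup V] [Module k V]

/-- The image of `W ⊗ W` in `V ⊗ V`, for a subspace `W` of `V`. -/
def tensorSquare (W : Submodule k V) : Submodule k (V ⊗[k] V) :=
  LinearMap.range (TensorProduct.map W.subtype W.subtype)

theorem tmul_mem_tensorSquare {W : Submodule k V} {a b : V} (ha : a ∈ W) (hb : b ∈ W) :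
    a ⊗ₜ[k] b ∈ tensorSquare W :=
  ⟨(⟨a, ha⟩ : W) ⊗ₜ (⟨b, hb⟩ : W), rfl⟩

theorem tensorSquare_induction {W : Submodule k V} {motive : V ⊗[k] V → Prop}
    (zero : motive 0) (tmul : ∀ a ∈ W, ∀ b ∈ W, motive (a ⊗ₜ b))
    (add : ∀ s t, motive s → motive t → motive (s + t)) {t : V ⊗[k] V}
    (ht : t ∈ tensorSquare W) : motive t := by
  obtain ⟨s, rfl⟩ := ht
  induction s with
  | zero => simpa using zero
  | tmul a b => exact tmul _ a.2 _ b.2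
  | add s t hs ht => rw [map_add]; exact add _ _ hs ht

theorem map_eq_zero_of_mem_tensorSquare {M : Type*} [AddCommGroup M] [Module k M]
    {W : Submodule k V} (φ : V ⊗[k] V →ₗ[k] M) (h : ∀ a ∈ W, ∀ b ∈ W, φ (a ⊗ₜ b) = 0)
    {t : V ⊗[k] V} (ht : t ∈ tensorSquare W) : φ t = 0 :=
  tensorSquare_induction (motive := fun t => φ t = 0) (map_zero φ) h
    (fun s t hs ht => by rw [map_add, hs, ht, add_zero]) ht

theorem tensorSquare_mono {W W' : Submodule k V} (h : W ≤ W') :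
    tensorSquare W ≤ tensorSquare W' := fun _ ht =>
  tensorSquare_induction (zero_mem _) (fun _ ha _ hb => tmul_mem_tensorSquare (h ha) (h hb))
    (fun _ _ => add_mem) ht

theorem tensorSquare_bot : tensorSquare (⊥ : Submodule k V) = ⊥ := by
  refine eq_bot_iff.mpr fun t ht => ?_
  refine tensorSquare_induction (zero_mem _) (fun a ha b _ => ?_) (fun _ _ => add_mem) ht
  simp [(Submodule.mem_bot k).mp ha]

theorem eq_zero_of_forall_dual {t : V ⊗[k] V}
    (h : ∀ f g : V →ₗ[k] k, LinearMap.mul' k k (TensorProduct.map f g t) = 0) : t = 0 := by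
  let b := Module.Free.chooseBasis k V
  refine (b.tensorProduct b).ext_elem fun ⟨i, j⟩ => ?_
  have key : (b.tensorProduct b).coord (i, j) =
      LinearMap.mul' k k ∘ₗ TensorProduct.map (b.coord i) (b.coord j) := by
    ext x y
    simp [Module.Basis.tensorProduct_repr_tmul_apply, mul_comm]
  rw [map_zero, Finsupp.zero_apply, ← h (b.coord i) (b.coord j)]
  exact LinearMap.congr_fun key t

/-- Membership in `W ⊗ W` is tested by the functionals vanishing on `W`. -/
theorem mem_tensorSquare_of_forall {W : Submodule k V} {t : V ⊗[k] V}
    (hl : ∀ f g : V →ₗ[k] k, (∀ w ∈ W, f w = 0) →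
      LinearMap.mul' k k (TensorProduct.map f g t) = 0)
    (hr : ∀ f g : V →ₗ[k] k, (∀ w ∈ W, g w = 0) →
      LinearMap.mul' k k (TensorProduct.map f g t) = 0) : t ∈ tensorSquare W := by
  obtain ⟨π, hπ⟩ := W.subtype.exists_leftInverse_of_injective W.ker_subtype
  have hπW : ∀ w ∈ W, W.subtype (π w) = w := fun w hw =>
    congrArg W.subtype (LinearMap.congr_fun hπ ⟨w, hw⟩)
  let ρ : V →ₗ[k] V := LinearMap.id - W.subtype ∘ₗ π
  have hρ : ∀ w ∈ W, ρ w = 0 := fun w hw => by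
    simp only [ρ, LinearMap.sub_apply, LinearMap.id_apply, LinearMap.comp_apply, hπW w hw, sub_self]
  have h1 : TensorProduct.map ρ LinearMap.id t = 0 := by
    refine eq_zero_of_forall_dual fun f g => ?_
    rw [← LinearMap.comp_apply (TensorProduct.map f g), ← TensorProduct.map_comp]
    exact hl _ _ fun w hw => by simp [hρ w hw]
  have h2 : TensorProduct.map LinearMap.id ρ t = 0 := by
    refine eq_zero_of_forall_dual fun f g => ?_
    rw [← LinearMap.comp_apply (TensorProduct.map f g), ← TensorProduct.map_comp]
    exact hr _ _ fun w hw => by simp [hρ w hw]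
  have e1 : TensorProduct.map (W.subtype ∘ₗ π) LinearMap.id t = t := by
    have : W.subtype ∘ₗ π = LinearMap.id - ρ := by simp [ρ]
    rw [this, sub_eq_add_neg, TensorProduct.map_add_left, ← neg_one_smul k ρ,
      TensorProduct.map_smul_left]
    simp [h1]
  have e2 : TensorProduct.map LinearMap.id (W.subtype ∘ₗ π) t = t := by
    have : W.subtype ∘ₗ π = LinearMap.id - ρ := by simp [ρ]
    rw [this, sub_eq_add_neg, TensorProduct.map_add_right, ← neg_one_smul k ρ,
      TensorProduct.map_smul_right]
    simp [h2]
  refine ⟨TensorProduct.map π π t, ?_⟩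
  rw [← LinearMap.comp_apply, ← TensorProduct.map_comp]
  conv_rhs => rw [← e1, ← e2]
  rw [← LinearMap.comp_apply, ← TensorProduct.map_comp, LinearMap.comp_id, LinearMap.id_comp]

end TensorSquare

/-- A coalgebra with a distinguished grouplike element `1`. -/
class IsCoaugmented (k A : Type*) [Field k] [Ring A] [Algebra k A] [Coalgebra k A] : Prop where
  comul_one' : (Coalgebra.comul (1 : A) : A ⊗[k] A) = 1 ⊗ₜ[k] 1
  counit_one' : (Coalgebra.counit (1 : A) : k) = 1

/-! ### Reduced comultiplication and conilpotency -/

section Filtration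

open Coalgebra WithConv

variable {k A : Type*} [Field k] [Ring A] [Algebra k A] [Coalgebra k A]

variable (k A) in
/-- The map `a ↦ Δ(a) - 1 ⊗ a - a ⊗ 1`, whose kernel is the space of primitive elements. -/
noncomputable def reducedComul : A →ₗ[k] A ⊗[k] A :=
  comul - TensorProduct.mk k A A 1 - (TensorProduct.mk k A A).flip 1

theorem reducedComul_apply (a : A) :
    reducedComul k A a = comul a - 1 ⊗ₜ[k] a - a ⊗ₜ[k] 1 := rfl

theorem comul_eq_reducedComul (a : A) :
    (comul a : A ⊗[k] A) = 1 ⊗ₜ[k] a + a ⊗ₜ[k] 1 + reducedComul k A a := by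
  rw [reducedComul_apply]; abel

theorem mem_primitives_iff {a : A} : a ∈ primitives k A ↔ reducedComul k A a = 0 := by
  rw [reducedComul_apply, sub_sub, sub_eq_zero]
  rfl

theorem comul_of_mem_primitives {a : A} (ha : a ∈ primitives k A) :
    (comul a : A ⊗[k] A) = 1 ⊗ₜ[k] a + a ⊗ₜ[k] 1 := ha

variable (k A) in
/-- The filtration `0 = F₀ ⊆ F₁ ⊆ ⋯` in which `F₁` consists of the primitive elements and `Fₙ₊₁` of
the elements whose reduced comultiplication lies in `Fₙ ⊗ Fₙ`. When `A` is irreducible,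
`k1 ⊕ Fₙ` is the `n`-th term of the coradical filtration. -/
noncomputable def primFiltration : ℕ → Submodule k A
  | 0 => ⊥
  | n + 1 => (tensorSquare (primFiltration n)).comap (reducedComul k A)

theorem mem_primFiltration_succ {n : ℕ} {a : A} :
    a ∈ primFiltration k A (n + 1) ↔ reducedComul k A a ∈ tensorSquare (primFiltration k A n) :=
  Iff.rfl

theorem primFiltration_zero : primFiltration k A 0 = ⊥ := rfl

theorem primFiltration_one : primFiltration k A 1 = primitives k A := by
  ext a
  rw [mem_primFiltration_succ, primFiltration_zero, tensorSquare_bot, Submodule.mem_bot,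
    mem_primitives_iff]

variable (k A) in
/-- `A` is conilpotent if the filtration `primFiltration` exhausts the augmentation ideal. -/
def IsConilpotent : Prop :=
  ∃ n, ∀ a : A, (counit a : k) = 0 → a ∈ primFiltration k A n

theorem convMul_apply_eq (f g : WithConv (A →ₗ[k] k)) (a : A) :
    (f * g) a = f 1 * g a + f a * g 1 +
      LinearMap.mul' k k (TensorProduct.map f.ofConv g.ofConv (reducedComul k A a)) := by
  rw [LinearMap.convMul_apply, comul_eq_reducedComul]
  simp

variable [IsCoaugmented k A]

variable (k) in
theorem comul_one_eq : (comul (1 : A) : A ⊗[k] A) = 1 ⊗ₜ[k] 1 := IsCoaugmented.comul_one'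

variable (k) in
theorem counit_one_eq : (counit (1 : A) : k) = 1 := IsCoaugmented.counit_one'

theorem counit_eq_zero_of_mem_primFiltration {n : ℕ} {a : A} (ha : a ∈ primFiltration k A n) :
    (counit a : k) = 0 := by
  induction n generalizing a with
  | zero => rw [(Submodule.mem_bot k).mp ha, map_zero]
  | succ n ih =>
    have h0 : LinearMap.mul' k k (TensorProduct.map counit counit (reducedComul k A a)) = 0 := by
      refine map_eq_zero_of_mem_tensorSquare (LinearMap.mul' k k ∘ₗ TensorProduct.map counit counit)
        (fun x hx y _ => by simp [ih hx]) (mem_primFiltration_succ.mp ha)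
    have h1 : LinearMap.mul' k k (TensorProduct.map counit counit (comul a : A ⊗[k] A)) =
        counit a := by
      have := congrArg (fun f : WithConv (A →ₗ[k] k) => f a) (one_mul (1 : WithConv (A →ₗ[k] k)))
      exact this
    simpa [reducedComul_apply, h1, counit_one_eq] using h0

theorem counit_eq_zero_of_mem_primitives {a : A} (ha : a ∈ primitives k A) :
    (counit a : k) = 0 :=
  counit_eq_zero_of_mem_primFiltration (primFiltration_one (k := k) (A := A) ▸ ha)

theorem convMul_apply_one (f g : WithConv (A →ₗ[k] k)) : (f * g) 1 = f 1 * g 1 := by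
  simp [comul_one_eq]

/-- In the dual algebra of a conilpotent coalgebra the functionals vanishing at `1` are
nilpotent. -/
theorem isNilpotent_of_apply_one_eq_zero (hA : IsConilpotent k A) {f : WithConv (A →ₗ[k] k)}
    (hf : f 1 = 0) : IsNilpotent f := by
  have h1 : ∀ n, (f ^ (n + 1)) 1 = 0 := fun n => by
    rw [pow_succ', convMul_apply_one, hf, zero_mul]
  have h2 : ∀ n, ∀ a ∈ primFiltration k A n, (f ^ (n + 1)) a = 0 := by
    intro n
    induction n with
    | zero =>
      intro a ha
      rw [(Submodule.mem_bot k).mp ha]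
      exact map_zero _
    | succ n ih =>
      intro a ha
      rw [pow_succ', convMul_apply_eq, hf, h1, zero_mul, mul_zero, add_zero, zero_add]
      refine map_eq_zero_of_mem_tensorSquare
        (LinearMap.mul' k k ∘ₗ TensorProduct.map f.ofConv (f ^ (n + 1)).ofConv)
        (fun x _ y hy => ?_) (mem_primFiltration_succ.mp ha)
      rw [LinearMap.comp_apply, TensorProduct.map_tmul, LinearMap.mul'_apply, ih y hy, mul_zero]
  obtain ⟨n, hn⟩ := hA
  refine ⟨n + 1, WithConv.ext (LinearMap.ext fun a => ?_)⟩
  have ha : a = algebraMap k A (counit a) + (a - algebraMap k A (counit a)) := by abel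
  have h3 := h2 n (a - algebraMap k A (counit a)) (hn _ (by
    rw [Algebra.algebraMap_eq_smul_one]; simp [counit_one_eq]))
  rw [ha, map_add, h3, Algebra.algebraMap_eq_smul_one, map_smul, h1]
  simp

theorem isUnit_of_apply_one_ne_zero (hA : IsConilpotent k A) {f : WithConv (A →ₗ[k] k)}
    (hf : f 1 ≠ 0) : IsUnit f := by
  have hnil : IsNilpotent (f - f 1 • (1 : WithConv (A →ₗ[k] k))) :=
    isNilpotent_of_apply_one_eq_zero hA (by
      change f 1 - f 1 • (1 : WithConv (A →ₗ[k] k)) 1 = 0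
      simp [counit_one_eq])
  have hu : IsUnit (f 1 • (1 : WithConv (A →ₗ[k] k))) := by
    rw [← Algebra.algebraMap_eq_smul_one]
    exact (IsUnit.mk0 _ hf).map _
  have := hnil.isUnit_add_right_of_commute hu
    ((Commute.one_right _).smul_right _)
  simpa using this

end Filtration

theorem dualCoannihilator_dualAnnihilator_eq_of_finite {k V : Type*} [Field k] [AddCommGroup V]
    [Module k V] [FiniteDimensional k V] (M : Submodule k (Module.Dual k V)) :
    M.dualCoannihilator.dualAnnihilator = M := by
  have : FiniteDimensional k (Module.Dual k V) := inferInstance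
  have : FiniteDimensional k M := FiniteDimensional.finiteDimensional_submodule M
  exact Subspace.dualCoannihilator_dualAnnihilator_eq

/-! ### Irreducible coalgebras are conilpotent -/

section Irreducible

open Coalgebra WithConv

variable {k A : Type*} [Field k] [Ring A] [Algebra k A] [Coalgebra k A] [FiniteDimensional k A]

theorem exists_simple_subcoalgebra_le {D : Submodule k A} (hD : IsSubcoalgebra k D) (h0 : D ≠ ⊥) :
    ∃ E ≤ D, IsSimpleSubcoalgebra k E := by
  obtain ⟨E, ⟨hE, hE0, hED⟩, hmin⟩ := (wellFounded_lt (α := Submodule k A)).has_min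
    {E | IsSubcoalgebra k E ∧ E ≠ ⊥ ∧ E ≤ D} ⟨D, hD, h0, le_rfl⟩
  refine ⟨E, hED, hE, hE0, fun E' hE' hle => or_iff_not_imp_left.mpr fun hne => ?_⟩
  exact hle.eq_of_not_lt (hmin E' ⟨hE', hne, hle.trans hED⟩)

/-- In an irreducible coalgebra every nonzero subcoalgebra contains `1`. -/
theorem one_mem_of_isSubcoalgebra (hirr : IsIrreducibleHopf k A) {D : Submodule k A}
    (hD : IsSubcoalgebra k D) (h0 : D ≠ ⊥) : (1 : A) ∈ D := by
  obtain ⟨E, hED, hE⟩ := exists_simple_subcoalgebra_le hD h0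
  obtain ⟨x, hx, hx0⟩ := Submodule.exists_mem_ne_zero_of_ne_bot hE.2.1
  have hx1 : x ∈ Submodule.span k {(1 : A)} := by
    rw [← hirr]
    exact le_sSup (show E ∈ {D | IsSimpleSubcoalgebra k D} from hE) hx
  obtain ⟨c, rfl⟩ := Submodule.mem_span_singleton.mp hx1
  have hc : c ≠ 0 := fun h => hx0 (by rw [h, zero_smul])
  exact hED ((Submodule.smul_mem_iff _ hc).mp hx)

/-- The annihilator of a two-sided ideal of the dual algebra is a subcoalgebra; hence in the
irreducible case the functionals in a proper two-sided ideal vanish at `1`. -/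
theorem apply_one_eq_zero_of_mem (hirr : IsIrreducibleHopf k A)
    (M : Ideal (WithConv (A →ₗ[k] k))) (hM : M.IsTwoSided) (hne : M ≠ ⊤)
    {f : WithConv (A →ₗ[k] k)} (hf : f ∈ M) : f 1 = 0 := by
  let M' : Submodule k (Module.Dual k A) :=
    (M.restrictScalars k).map (WithConv.linearEquiv k (A →ₗ[k] k)).toLinearMap
  have hmem : ∀ g : A →ₗ[k] k, g ∈ M' → toConv g ∈ M := by
    rintro g ⟨g', hg', rfl⟩
    exact hg'
  have hmem' : ∀ g ∈ M, ofConv g ∈ M' := fun g hg => ⟨g, hg, rfl⟩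
  have hann : M'.dualCoannihilator.dualAnnihilator = M' :=
    dualCoannihilator_dualAnnihilator_eq_of_finite _
  have hpair : ∀ f g : A →ₗ[k] k, toConv f * toConv g ∈ M → ∀ c ∈ M'.dualCoannihilator,
      LinearMap.mul' k k (TensorProduct.map f g (comul c)) = 0 := fun f g hfg c hc =>
    (Submodule.mem_dualCoannihilator c).mp hc _ (hmem' _ hfg)
  have hD : IsSubcoalgebra k M'.dualCoannihilator := by
    intro c hc
    refine mem_tensorSquare_of_forall (fun f g hf' => ?_) (fun f g hg' => ?_)
    · have hfM : f ∈ M' := hann ▸ (Submodule.mem_dualAnnihilator f).mpr hf'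
      exact hpair f g (Ideal.mul_mem_right _ _ (hmem f hfM)) c hc
    · have hgM : g ∈ M' := hann ▸ (Submodule.mem_dualAnnihilator g).mpr hg'
      exact hpair f g (Ideal.mul_mem_left _ _ (hmem g hgM)) c hc
  have h0 : M'.dualCoannihilator ≠ ⊥ := by
    intro h
    rw [h, Submodule.dualAnnihilator_bot] at hann
    refine hne ((Ideal.eq_top_iff_one _).mpr ?_)
    have : (1 : WithConv (A →ₗ[k] k)).ofConv ∈ M' := hann ▸ Submodule.mem_top
    exact hmem _ this
  exact (Submodule.mem_dualCoannihilator _).mp (one_mem_of_isSubcoalgebra hirr hD h0) _ (hmem' f hf)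

variable [IsCoaugmented k A]

variable (k A) in
/-- Evaluation at `1`, as a character of the dual algebra. -/
noncomputable def evalOne : WithConv (A →ₗ[k] k) →+* k where
  toFun f := f 1
  map_one' := by simp [counit_one_eq]
  map_mul' f g := convMul_apply_one f g
  map_zero' := rfl
  map_add' _ _ := rfl

/-- If `J` is the ideal of functionals vanishing at `1`, then the elements of the augmentation ideal
killed by `J ^ n` lie in the `n`-th filtration step. -/
theorem mem_primFiltration_of_forall {J : Ideal (WithConv (A →ₗ[k] k))}
    (hJ : J = RingHom.ker (evalOne k A)) (n : ℕ) {a : A} (h0 : (counit a : k) = 0)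
    (ha : ∀ f ∈ J ^ n, f a = 0) : a ∈ primFiltration k A n := by
  have hJ1 : ∀ f, f ∈ J ↔ f 1 = 0 := fun f => by rw [hJ]; rfl
  have : J.IsTwoSided := hJ ▸ inferInstance
  induction n generalizing a with
  | zero =>
    refine (Submodule.mem_bot k).mpr ((Module.forall_dual_apply_eq_zero_iff k a).mp fun f => ?_)
    exact ha (toConv f) (by rw [Submodule.pow_zero, Ideal.one_eq_top]; trivial)
  | succ n ih =>
    rw [mem_primFiltration_succ]
    let M : Submodule k (Module.Dual k A) :=
      ((J ^ n).restrictScalars k).map (WithConv.linearEquiv k (A →ₗ[k] k)).toLinearMap ⊔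
        Submodule.span k {(counit : A →ₗ[k] k)}
    have hann : M.dualCoannihilator.dualAnnihilator = M :=
      dualCoannihilator_dualAnnihilator_eq_of_finite _
    have hle : M.dualCoannihilator ≤ primFiltration k A n := by
      intro b hb
      rw [Submodule.mem_dualCoannihilator] at hb
      exact ih (hb _ (Submodule.mem_sup_right (Submodule.mem_span_singleton_self _)))
        fun f hf => hb _ (Submodule.mem_sup_left ⟨f, hf, rfl⟩)
    have hsplit : ∀ f : A →ₗ[k] k, (∀ w ∈ M.dualCoannihilator, f w = 0) →
        ∃ j : WithConv (A →ₗ[k] k), j ∈ J ^ n ∧ ∃ c : k, f = j.ofConv + c • counit := by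
      intro f hf
      have : f ∈ M := hann ▸ (Submodule.mem_dualAnnihilator f).mpr hf
      obtain ⟨_, ⟨j, hj, rfl⟩, _, hc, rfl⟩ := Submodule.mem_sup.mp this
      obtain ⟨c, rfl⟩ := Submodule.mem_span_singleton.mp hc
      exact ⟨j, hj, c, rfl⟩
    -- subtracting a multiple of the counit moves a functional into `J`
    have hsub : ∀ g : WithConv (A →ₗ[k] k), g - g 1 • 1 ∈ J := fun g => (hJ1 _).mpr (by
      change g 1 - g 1 • (1 : WithConv (A →ₗ[k] k)) 1 = 0
      simp [counit_one_eq])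
    have hone : (1 : WithConv (A →ₗ[k] k)) a = 0 := by simp [h0]
    have hprod : ∀ j ∈ J ^ n, ∀ g : WithConv (A →ₗ[k] k), j 1 * g a = 0 := by
      intro j hj g
      rcases Nat.eq_zero_or_pos n with rfl | hn
      · have := ha _ (by rw [zero_add, Submodule.pow_one]; exact hsub g)
        change g a - g 1 • (1 : WithConv (A →ₗ[k] k)) a = 0 at this
        rw [hone, smul_zero, sub_zero] at this
        rw [this, mul_zero]
      · rw [(hJ1 j).mp (Ideal.pow_le_self hn.ne' hj), zero_mul]
    have hL : ∀ j ∈ J ^ n, ∀ g : WithConv (A →ₗ[k] k),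
        LinearMap.mul' k k (TensorProduct.map j.ofConv g.ofConv (reducedComul k A a)) = 0 := by
      intro j hj g
      have h1 : (j * (g - g 1 • 1)) a = 0 :=
        ha _ (by rw [Submodule.pow_succ]; exact Ideal.mul_mem_mul hj (hsub g))
      have h2 : (j * g) a = g 1 * j a := by
        rw [mul_sub, mul_smul_comm, mul_one] at h1
        exact sub_eq_zero.mp h1
      rw [convMul_apply_eq, hprod j hj g, zero_add] at h2
      linear_combination h2
    have hR : ∀ j ∈ J ^ n, ∀ g : WithConv (A →ₗ[k] k),
        LinearMap.mul' k k (TensorProduct.map g.ofConv j.ofConv (reducedComul k A a)) = 0 := by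
      intro j hj g
      have h1 : ((g - g 1 • 1) * j) a = 0 :=
        ha _ (by rw [Ideal.IsTwoSided.pow_succ]; exact Ideal.mul_mem_mul (hsub g) hj)
      have h2 : (g * j) a = g 1 * j a := by
        rw [sub_mul, smul_mul_assoc, one_mul] at h1
        exact sub_eq_zero.mp h1
      rw [convMul_apply_eq, mul_comm (g a), hprod j hj g, add_zero] at h2
      linear_combination h2
    have hcl : ∀ g : WithConv (A →ₗ[k] k),
        LinearMap.mul' k k (TensorProduct.map counit g.ofConv (reducedComul k A a)) = 0 := by
      intro g
      have h2 : ((1 : WithConv (A →ₗ[k] k)) * g) a = g a := by rw [one_mul]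
      rw [convMul_apply_eq, hone, LinearMap.convOne_apply, counit_one_eq] at h2
      have h3 : LinearMap.mul' k k (TensorProduct.map (1 : WithConv (A →ₗ[k] k)).ofConv g.ofConv
        (reducedComul k A a)) = 0 := by simpa using h2
      exact h3
    have hcr : ∀ g : WithConv (A →ₗ[k] k),
        LinearMap.mul' k k (TensorProduct.map g.ofConv counit (reducedComul k A a)) = 0 := by
      intro g
      have h2 : (g * (1 : WithConv (A →ₗ[k] k))) a = g a := by rw [mul_one]
      rw [convMul_apply_eq, hone, LinearMap.convOne_apply, counit_one_eq] at h2
      have h3 : LinearMap.mul' k k (TensorProduct.map g.ofConv (1 : WithConv (A →ₗ[k] k)).ofConv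
        (reducedComul k A a)) = 0 := by simpa using h2
      exact h3
    refine tensorSquare_mono hle (mem_tensorSquare_of_forall (fun f g hf => ?_) fun g f hf => ?_)
    · obtain ⟨j, hj, c, rfl⟩ := hsplit f hf
      rw [TensorProduct.map_add_left, TensorProduct.map_smul_left, LinearMap.add_apply,
        LinearMap.smul_apply, map_add, map_smul, hcl (toConv g), hL j hj (toConv g), smul_zero,
        add_zero]
    · obtain ⟨j, hj, c, rfl⟩ := hsplit f hf
      rw [TensorProduct.map_add_right, TensorProduct.map_smul_right, LinearMap.add_apply,
        LinearMap.smul_apply, map_add, map_smul, hcr (toConv g), hR j hj (toConv g), smul_zero,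
        add_zero]

/-- The functionals vanishing at `1` form the Jacobson radical of the dual algebra of an
irreducible coalgebra, so its powers vanish eventually. -/
theorem IsIrreducibleHopf.isConilpotent (hirr : IsIrreducibleHopf k A) : IsConilpotent k A := by
  have : FiniteDimensional k (WithConv (A →ₗ[k] k)) :=
    Module.Finite.equiv (WithConv.linearEquiv k (A →ₗ[k] k)).symm
  obtain ⟨n, hn⟩ := isNilpotent_ker_of_forall_le (evalOne k A) fun M hM hne f hf =>
    apply_one_eq_zero_of_mem hirr M hM hne hf
  refine ⟨n, fun a ha => mem_primFiltration_of_forall rfl n ha fun f hf => ?_⟩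
  rw [hn] at hf
  rw [(Submodule.mem_bot _).mp hf]
  rfl

end Irreducible

/-! ### Frobenius maps on commutative subspaces -/

section FrobeniusLinear

variable {K B : Type*} [Field K] [Ring B] [Algebra K B] (p : ℕ) [Fact p.Prime] [CharP B p]

theorem sum_pow_char_of_commute {ι : Type*} (s : Finset ι) (f : ι → B)
    (h : ∀ i j, Commute (f i) (f j)) : (∑ i ∈ s, f i) ^ p = ∑ i ∈ s, f i ^ p := by
  classical
  induction s using Finset.induction_on with
  | empty => simp [(Fact.out : p.Prime).ne_zero]
  | insert i s hi ih =>
    rw [Finset.sum_insert hi, Finset.sum_insert hi,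
      add_pow_char_of_commute p (Commute.sum_right _ _ _ fun j _ => h i j), ih]

theorem sum_smul_pow_char_of_commute {ι : Type*} (s : Finset ι) (c : ι → K) (f : ι → B)
    (h : ∀ i j, Commute (f i) (f j)) :
    (∑ i ∈ s, c i • f i) ^ p = ∑ i ∈ s, c i ^ p • f i ^ p := by
  rw [sum_pow_char_of_commute p s _ fun i j => ((h i j).smul_left _).smul_right _]
  exact Finset.sum_congr rfl fun i _ => smul_pow _ _ _

theorem eq_zero_of_pow_char_eq_zero_of_linearIndependent {ι : Type*} [Fintype ι] {v : ι → B}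
    (hc : ∀ i j, Commute (v i) (v j)) (hv : LinearIndependent K fun i => v i ^ p) {c : ι → K}
    (h : (∑ i, c i • v i) ^ p = 0) : ∑ i, c i • v i = 0 := by
  rw [sum_smul_pow_char_of_commute p _ _ _ hc] at h
  refine Finset.sum_eq_zero fun i _ => ?_
  rw [eq_zero_of_pow_eq_zero (Fintype.linearIndependent_iff.mp hv _ h i), zero_smul]

/-- If `[a, b]` commutes with `a`, then `[a ^ p, b] = p a ^ (p - 1) [a, b] = 0`. -/
theorem commute_pow_char {a b : B} (h : Commute a (a * b - b * a)) : Commute (a ^ p) b := by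
  have key : ∀ n : ℕ, a ^ (n + 1) * b =
      b * a ^ (n + 1) + (n + 1 : ℕ) • (a ^ n * (a * b - b * a)) := by
    intro n
    induction n with
    | zero => simp
    | succ n ih =>
      have h1 : a ^ (n + 1) * (a * b) = a ^ (n + 1) * b * a + a ^ (n + 1) * (a * b - b * a) := by
        rw [mul_sub, mul_assoc, add_sub_cancel]
      have h2 : a ^ n * (a * b - b * a) * a = a ^ (n + 1) * (a * b - b * a) := by
        rw [mul_assoc, ← h.eq, ← mul_assoc, pow_succ]
      rw [pow_succ a (n + 1), mul_assoc, h1, ih, add_mul, mul_assoc, smul_mul_assoc, h2,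
        succ_nsmul _ (n + 1), ← add_assoc]
  have hp := key (p - 1)
  rw [Nat.sub_add_cancel (Fact.out : p.Prime).one_le, ← Nat.cast_smul_eq_nsmul B,
    CharP.cast_eq_zero, zero_smul, add_zero] at hp
  exact hp

variable [CharP K p] [PerfectRing K p]

theorem exists_pow_char_eq (c : K) : ∃ d : K, d ^ p = c := surjective_frobenius K p c

/-- On a commutative subspace without `p`-nilpotent elements the Frobenius map preserves linear
independence, since every scalar is a `p`-th power. -/
theorem linearIndependent_pow_char {W : Submodule K B} (hcomm : ∀ a ∈ W, ∀ b ∈ W, Commute a b)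
    (hinj : ∀ a ∈ W, a ^ p = 0 → a = 0) {ι : Type*} {w : ι → B} (hw : ∀ i, w i ∈ W)
    (hli : LinearIndependent K w) : LinearIndependent K fun i => w i ^ p := by
  rw [linearIndependent_iff'] at hli ⊢
  intro s c hc i hi
  choose d hd using fun i => exists_pow_char_eq p (c i)
  have h0 : (∑ i ∈ s, d i • w i) ^ p = 0 := by
    rw [sum_smul_pow_char_of_commute p _ _ _ fun i j => hcomm _ (hw i) _ (hw j), ← hc]
    exact Finset.sum_congr rfl fun i _ => by rw [hd]
  rw [← hd, hli s d (hinj _ (sum_mem fun i _ => W.smul_mem _ (hw i)) h0) i hi,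
    zero_pow (Fact.out : p.Prime).ne_zero]

theorem exists_pow_char_eq_of_mem {W : Submodule K B} [FiniteDimensional K W]
    (hcomm : ∀ a ∈ W, ∀ b ∈ W, Commute a b) (hst : ∀ a ∈ W, a ^ p ∈ W)
    (hinj : ∀ a ∈ W, a ^ p = 0 → a = 0) {y : B} (hy : y ∈ W) : ∃ x ∈ W, x ^ p = y := by
  let b := Module.finBasis K W
  have hli : LinearIndependent K fun i => (b i : B) ^ p :=
    linearIndependent_pow_char p hcomm hinj (fun i => (b i).2)
      (b.linearIndependent.map' W.subtype W.ker_subtype)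
  let v : Fin (Module.finrank K W) → W := fun i => ⟨(b i : B) ^ p, hst _ (b i).2⟩
  have hv : LinearIndependent K v := LinearIndependent.of_comp W.subtype hli
  have hspan := hv.span_eq_top_of_card_eq_finrank' (by simp)
  have hmem : (⟨y, hy⟩ : W) ∈ Submodule.span K (Set.range v) := hspan ▸ Submodule.mem_top
  obtain ⟨c, hc⟩ := (Submodule.mem_span_range_iff_exists_fun K).mp hmem
  choose d hd using fun i => exists_pow_char_eq p (c i)
  refine ⟨∑ i, d i • (b i : B), sum_mem fun i _ => W.smul_mem _ (b i).2, ?_⟩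
  rw [sum_smul_pow_char_of_commute p _ _ _ fun i j => hcomm _ (b i).2 _ (b j).2]
  have := congrArg W.subtype hc
  rw [map_sum] at this
  rw [← show W.subtype ⟨y, hy⟩ = y from rfl, ← this]
  exact Finset.sum_congr rfl fun i _ => by rw [hd]; rfl

end FrobeniusLinear

/-! ### Tensor squares of commutative subspaces -/

section TensorSquareAlgebra

variable {K B : Type*} [Field K] [Ring B] [Algebra K B]

theorem commute_of_mem_tensorSquare {W W' : Submodule K B}
    (h : ∀ a ∈ W, ∀ b ∈ W', Commute a b) {s t : B ⊗[K] B} (hs : s ∈ tensorSquare W)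
    (ht : t ∈ tensorSquare W') : Commute s t := by
  refine tensorSquare_induction (motive := fun s => Commute s t) (Commute.zero_left _)
    (fun a ha b hb => ?_) (fun _ _ h1 h2 => h1.add_left h2) hs
  refine tensorSquare_induction (motive := fun t => Commute (a ⊗ₜ b) t) (Commute.zero_right _)
    (fun a' ha' b' hb' => ?_) (fun _ _ h1 h2 => h1.add_right h2) ht
  rw [Commute, SemiconjBy, Algebra.TensorProduct.tmul_mul_tmul, Algebra.TensorProduct.tmul_mul_tmul,
    (h a ha a' ha').eq, (h b hb b' hb').eq]

theorem commute_tmul_one_of_mem_tensorSquare {W : Submodule K B} {a : B}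
    (h : ∀ b ∈ W, Commute a b) {t : B ⊗[K] B} (ht : t ∈ tensorSquare W) :
    Commute (a ⊗ₜ[K] (1 : B)) t := by
  refine tensorSquare_induction (motive := fun t => Commute (a ⊗ₜ[K] (1 : B)) t)
    (Commute.zero_right _) (fun a' ha' b' _ => ?_) (fun _ _ h1 h2 => h1.add_right h2) ht
  rw [Commute, SemiconjBy, Algebra.TensorProduct.tmul_mul_tmul, Algebra.TensorProduct.tmul_mul_tmul,
    (h a' ha').eq, one_mul, mul_one]

theorem commute_one_tmul_of_mem_tensorSquare {W : Submodule K B} {a : B}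
    (h : ∀ b ∈ W, Commute a b) {t : B ⊗[K] B} (ht : t ∈ tensorSquare W) :
    Commute ((1 : B) ⊗ₜ[K] a) t := by
  refine tensorSquare_induction (motive := fun t => Commute ((1 : B) ⊗ₜ[K] a) t)
    (Commute.zero_right _) (fun a' _ b' hb' => ?_) (fun _ _ h1 h2 => h1.add_right h2) ht
  rw [Commute, SemiconjBy, Algebra.TensorProduct.tmul_mul_tmul, Algebra.TensorProduct.tmul_mul_tmul,
    (h b' hb').eq, one_mul, mul_one]

theorem commute_tmul_one_one_tmul (a b : B) : Commute (a ⊗ₜ[K] (1 : B)) ((1 : B) ⊗ₜ[K] b) := by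
  rw [Commute, SemiconjBy, Algebra.TensorProduct.tmul_mul_tmul, Algebra.TensorProduct.tmul_mul_tmul,
    one_mul, mul_one, one_mul, mul_one]

variable (p : ℕ) [Fact p.Prime] [CharP (B ⊗[K] B) p]

theorem pow_char_mem_tensorSquare {W : Submodule K B} (hcomm : ∀ a ∈ W, ∀ b ∈ W, Commute a b)
    (hst : ∀ a ∈ W, a ^ p ∈ W) {t : B ⊗[K] B} (ht : t ∈ tensorSquare W) :
    t ^ p ∈ tensorSquare W := by
  refine (tensorSquare_induction (motive := fun t => t ∈ tensorSquare W ∧ t ^ p ∈ tensorSquare W)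
    ⟨zero_mem _, ?_⟩ (fun a ha b hb => ⟨tmul_mem_tensorSquare ha hb, ?_⟩)
    (fun s t hs ht => ⟨add_mem hs.1 ht.1, ?_⟩) ht).2
  · rw [zero_pow (Fact.out : p.Prime).ne_zero]
    exact zero_mem _
  · rw [Algebra.TensorProduct.tmul_pow]
    exact tmul_mem_tensorSquare (hst a ha) (hst b hb)
  · rw [add_pow_char_of_commute p (commute_of_mem_tensorSquare hcomm hs.1 ht.1)]
    exact add_mem hs.2 ht.2

theorem eq_zero_of_pow_char_eq_zero_of_mem_tensorSquare [CharP B p] [CharP K p] [PerfectRing K p]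
    {W : Submodule K B} [FiniteDimensional K W] (hcomm : ∀ a ∈ W, ∀ b ∈ W, Commute a b)
    (hinj : ∀ a ∈ W, a ^ p = 0 → a = 0) {t : B ⊗[K] B} (ht : t ∈ tensorSquare W)
    (h0 : t ^ p = 0) : t = 0 := by
  let b := Module.finBasis K W
  have hb : LinearIndependent K fun i => (b i : B) ^ p :=
    linearIndependent_pow_char p hcomm hinj (fun i => (b i).2)
      (b.linearIndependent.map' W.subtype W.ker_subtype)
  obtain ⟨s, rfl⟩ := ht
  rw [← (b.tensorProduct b).sum_repr s, map_sum] at h0 ⊢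
  simp only [map_smul, Module.Basis.tensorProduct_apply', TensorProduct.map_tmul,
    Submodule.subtype_apply] at h0 ⊢
  refine eq_zero_of_pow_char_eq_zero_of_linearIndependent p (fun i j => ?_) ?_ h0
  · exact commute_of_mem_tensorSquare hcomm (tmul_mem_tensorSquare (b i.1).2 (b i.2).2)
      (tmul_mem_tensorSquare (b j.1).2 (b j.2).2)
  · simp only [Algebra.TensorProduct.tmul_pow]
    exact LinearIndependent.tmul_of_flat_left (v := fun i => (b i : B) ^ p)
      (w := fun i => (b i : B) ^ p) hb hb

end TensorSquareAlgebra

/-! ### Commutativity and reducedness -/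

instance Bialgebra.isCoaugmented {k A : Type*} [Field k] [Ring A] [Bialgebra k A] :
    IsCoaugmented k A :=
  ⟨Bialgebra.comul_one, Bialgebra.counit_one⟩

section Commutativity

open Coalgebra

variable {K B : Type*} [Field K] [Ring B] [Bialgebra K B]

theorem add_mul_add_sub_of_commute {R : Type*} [Ring R] {x y s t : R} (hxt : Commute x t)
    (hys : Commute y s) (hst : Commute s t) :
    (x + s) * (y + t) - (y + t) * (x + s) = x * y - y * x := by
  rw [add_mul, mul_add, mul_add, add_mul, mul_add, mul_add, hxt.eq, hys.eq, hst.eq]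
  abel

/-- The commutator of two elements is primitive if they commute with the lower terms of the
filtration, as then only the parts `1 ⊗ a + a ⊗ 1` contribute to the commutator of their
comultiplications. -/
theorem mul_sub_mul_mem_primitives {m n : ℕ}
    (h1 : ∀ a ∈ primFiltration K B m, ∀ b ∈ primFiltration K B n, Commute a b)
    (h2 : ∀ a ∈ primFiltration K B (m + 1), ∀ b ∈ primFiltration K B n, Commute a b)
    (h3 : ∀ a ∈ primFiltration K B m, ∀ b ∈ primFiltration K B (n + 1), Commute a b)
    {a b : B} (ha : a ∈ primFiltration K B (m + 1)) (hb : b ∈ primFiltration K B (n + 1)) :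
    a * b - b * a ∈ primitives K B := by
  rw [mem_primFiltration_succ] at ha hb
  have hst := commute_of_mem_tensorSquare h1 ha hb
  have hat : Commute (1 ⊗ₜ[K] a + a ⊗ₜ[K] 1) (reducedComul K B b) :=
    (commute_one_tmul_of_mem_tensorSquare (h2 a ha) hb).add_left
      (commute_tmul_one_of_mem_tensorSquare (h2 a ha) hb)
  have hbs : Commute (1 ⊗ₜ[K] b + b ⊗ₜ[K] 1) (reducedComul K B a) :=
    (commute_one_tmul_of_mem_tensorSquare (fun x hx => (h3 x hx b hb).symm) ha).add_left
      (commute_tmul_one_of_mem_tensorSquare (fun x hx => (h3 x hx b hb).symm) ha)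
  change comul (a * b - b * a) = _
  rw [map_sub, Bialgebra.comul_mul, Bialgebra.comul_mul, comul_eq_reducedComul a,
    comul_eq_reducedComul b, add_mul_add_sub_of_commute hat hbs hst, TensorProduct.tmul_sub,
    TensorProduct.sub_tmul]
  simp only [add_mul, mul_add, Algebra.TensorProduct.tmul_mul_tmul, one_mul, mul_one]
  abel

theorem sub_algebraMap_counit_mem {N : ℕ}
    (hN : ∀ a : B, (counit a : K) = 0 → a ∈ primFiltration K B N) (a : B) :
    a - algebraMap K B (counit a) ∈ primFiltration K B N :=
  hN _ (by rw [map_sub, Bialgebra.counit_algebraMap, sub_self])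

variable (p : ℕ) [Fact p.Prime] [CharP (B ⊗[K] B) p]

/-- As `1 ⊗ a + a ⊗ 1` commutes with the reduced comultiplication of `a`, the latter is compatible
with `p`-th powers. -/
theorem reducedComul_pow_char {m : ℕ}
    (h : ∀ a ∈ primFiltration K B (m + 1), ∀ b ∈ primFiltration K B m, Commute a b)
    {a : B} (ha : a ∈ primFiltration K B (m + 1)) :
    reducedComul K B (a ^ p) = reducedComul K B a ^ p := by
  have ha' := mem_primFiltration_succ.mp ha
  have hc : Commute (1 ⊗ₜ[K] a + a ⊗ₜ[K] 1) (reducedComul K B a) :=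
    (commute_one_tmul_of_mem_tensorSquare (h a ha) ha').add_left
      (commute_tmul_one_of_mem_tensorSquare (h a ha) ha')
  rw [reducedComul_apply, Bialgebra.comul_pow, comul_eq_reducedComul a,
    add_pow_char_of_commute p hc, add_pow_char_of_commute p (commute_tmul_one_one_tmul a a).symm,
    Algebra.TensorProduct.tmul_pow, Algebra.TensorProduct.tmul_pow, one_pow]
  abel

theorem pow_char_mem_primitives {a : B} (ha : a ∈ primitives K B) : a ^ p ∈ primitives K B := by
  rw [mem_primitives_iff, reducedComul_pow_char p (m := 0) (fun a _ b hb => ?_)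
    (primFiltration_one (k := K) (A := B) ▸ ha), mem_primitives_iff.mp ha,
    zero_pow (Fact.out : p.Prime).ne_zero]
  rw [(Submodule.mem_bot K).mp hb]
  exact Commute.zero_right a

variable [CharP B p] [CharP K p] [PerfectRing K p] [FiniteDimensional K B]

/-- When enough of the filtration commutes, the Frobenius map is injective on its terms, preserves
them, and is surjective up to primitive elements. -/
theorem frobenius_on_primFiltration (hinj : ∀ u ∈ primitives K B, u ^ p = 0 → u = 0) (m : ℕ)
    (h : ∀ i j, i + j < 2 * m →
      ∀ a ∈ primFiltration K B i, ∀ b ∈ primFiltration K B j, Commute a b) :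
    (∀ a ∈ primFiltration K B m, a ^ p ∈ primFiltration K B m) ∧
    (∀ a ∈ primFiltration K B m, a ^ p = 0 → a = 0) ∧
    (∀ a ∈ primFiltration K B m, ∃ x ∈ primFiltration K B m, a - x ^ p ∈ primitives K B) := by
  have hp0 : p ≠ 0 := (Fact.out : p.Prime).ne_zero
  induction m with
  | zero =>
    have h0 : ∀ a ∈ primFiltration K B 0, a = 0 := fun a ha => (Submodule.mem_bot K).mp ha
    refine ⟨fun a ha => ?_, fun a ha _ => h0 a ha, fun a ha => ⟨0, zero_mem _, ?_⟩⟩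
    · rw [h0 a ha, zero_pow hp0]
      exact zero_mem _
    · rw [h0 a ha, zero_pow hp0, sub_zero]
      exact zero_mem _
  | succ m ih =>
    obtain ⟨hst, hin, -⟩ := ih fun i j hij => h i j (by omega)
    have hmm := h m m (by omega)
    have hsm := h (m + 1) m (by omega)
    have hst' : ∀ a ∈ primFiltration K B (m + 1), a ^ p ∈ primFiltration K B (m + 1) := by
      intro a ha
      rw [mem_primFiltration_succ, reducedComul_pow_char p hsm ha]
      exact pow_char_mem_tensorSquare p hmm hst (mem_primFiltration_succ.mp ha)
    refine ⟨hst', fun a ha h0 => hinj a ?_ h0, fun a ha => ?_⟩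
    · rw [mem_primitives_iff]
      refine eq_zero_of_pow_char_eq_zero_of_mem_tensorSquare p hmm hin
        (mem_primFiltration_succ.mp ha) ?_
      rw [← reducedComul_pow_char p hsm ha, h0, map_zero]
    · -- Frobenius is bijective on the image of `F (m + 1)` under the reduced comultiplication
      let V := (primFiltration K B (m + 1)).map (reducedComul K B)
      have hV : ∀ t ∈ V, t ∈ tensorSquare (primFiltration K B m) := by
        rintro _ ⟨x, hx, rfl⟩
        exact hx
      obtain ⟨_, ⟨x, hx, rfl⟩, hxa⟩ := exists_pow_char_eq_of_mem p (W := V)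
        (fun s hs t ht => commute_of_mem_tensorSquare hmm (hV s hs) (hV t ht))
        (by
          rintro _ ⟨x, hx, rfl⟩
          exact ⟨x ^ p, hst' x hx, reducedComul_pow_char p hsm hx⟩)
        (fun t ht => eq_zero_of_pow_char_eq_zero_of_mem_tensorSquare p hmm hin (hV t ht))
        (Submodule.mem_map_of_mem (f := reducedComul K B) ha)
      refine ⟨x, hx, ?_⟩
      rw [mem_primitives_iff, map_sub, reducedComul_pow_char p hsm hx, hxa, sub_self]

/-- If the primitive elements commute and none is `p`-nilpotent, the whole filtration commutes.
The commutator of two elements for which all lower commutators vanish is primitive, hence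
commutes with both; so `p`-th powers commute with everything in the filtration term, and up to
primitive elements every element is a `p`-th power. -/
theorem commute_of_mem_primFiltration
    (hcomm : ∀ u ∈ primitives K B, ∀ v ∈ primitives K B, Commute u v)
    (hinj : ∀ u ∈ primitives K B, u ^ p = 0 → u = 0) (N m n : ℕ) (hN : m + n ≤ N) :
    ∀ a ∈ primFiltration K B m, ∀ b ∈ primFiltration K B n, Commute a b := by
  induction N generalizing m n with
  | zero =>
    obtain rfl : m = 0 := by omega
    intro a ha b _
    rw [(Submodule.mem_bot K).mp ha]
    exact Commute.zero_left b
  | succ N ih =>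
    wlog hmn : m ≤ n generalizing m n
    · exact fun a ha b hb => (this n m (by omega) (by omega) b hb a ha).symm
    rcases m with _ | m
    · intro a ha b _
      rw [(Submodule.mem_bot K).mp ha]
      exact Commute.zero_left b
    obtain ⟨n, rfl⟩ : ∃ n', n = n' + 1 := ⟨n - 1, by omega⟩
    intro a ha b hb
    have hprim : ∀ x ∈ primFiltration K B (m + 1), x * b - b * x ∈ primitives K B := fun x hx =>
      mul_sub_mul_mem_primitives (ih m n (by omega)) (ih (m + 1) n (by omega))
        (ih m (n + 1) (by omega)) hx hb
    have hPF : ∀ x, x ∈ primitives K B ↔ x ∈ primFiltration K B 1 := fun x => by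
      rw [primFiltration_one]
    have hP : ∀ u ∈ primitives K B, Commute u b := by
      rcases Nat.eq_zero_or_pos m with rfl | hm
      · intro u hu
        obtain ⟨x, hx, rfl⟩ := exists_pow_char_eq_of_mem p hcomm
          (fun _ => pow_char_mem_primitives p) hinj hu
        exact commute_pow_char p (hcomm x hx _ (hprim x ((hPF x).mp hx)))
      · exact fun u hu => ih 1 (n + 1) (by omega) u ((hPF u).mp hu) b hb
    have hpow : ∀ x ∈ primFiltration K B (m + 1), Commute (x ^ p) b := by
      intro x hx
      refine commute_pow_char p ?_
      rcases Nat.eq_zero_or_pos n with rfl | hn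
      · obtain rfl : m = 0 := by omega
        exact hcomm x ((hPF x).mpr hx) _ (hprim x hx)
      · exact ih (m + 1) 1 (by omega) x hx _ ((hPF _).mp (hprim x hx))
    obtain ⟨x, hx, hax⟩ := (frobenius_on_primFiltration p hinj (m + 1)
      fun i j hij => ih i j (by omega)).2.2 a ha
    rw [← sub_add_cancel a (x ^ p)]
    exact (hP _ hax).add_left (hpow x hx)

/-- A conilpotent bialgebra is commutative if its primitive elements commute and none of them is
`p`-nilpotent. -/
theorem commute_of_primitives (hB : IsConilpotent K B)
    (hcomm : ∀ u ∈ primitives K B, ∀ v ∈ primitives K B, Commute u v)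
    (hinj : ∀ u ∈ primitives K B, u ^ p = 0 → u = 0) (a b : B) : Commute a b := by
  obtain ⟨N, hN⟩ := hB
  have h := commute_of_mem_primFiltration p hcomm hinj (N + N) N N le_rfl _
    (sub_algebraMap_counit_mem hN a) _ (sub_algebraMap_counit_mem hN b)
  have h' := (h.add_left (Algebra.commutes (counit a : K) _)).add_right
    (Algebra.commutes (counit b : K) _).symm
  simpa using h'

theorem isReduced_of_primitives (hB : IsConilpotent K B)
    (hcomm : ∀ u ∈ primitives K B, ∀ v ∈ primitives K B, Commute u v)
    (hinj : ∀ u ∈ primitives K B, u ^ p = 0 → u = 0) : IsReduced B := by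
  have hnil : ∀ a : B, a ^ p = 0 → a = 0 := by
    intro a ha
    obtain ⟨N, hN⟩ := id hB
    have h0 : (counit a : K) = 0 := by
      refine eq_zero_of_pow_eq_zero (n := p) ?_
      rw [← Bialgebra.counit_pow, ha, map_zero]
    exact (frobenius_on_primFiltration p hinj N fun _ _ _ a _ b _ =>
      commute_of_primitives p hB hcomm hinj a b).2.1 a (hN a h0) ha
  have hpow : ∀ (n : ℕ) (a : B), a ^ p ^ n = 0 → a = 0 := by
    intro n
    induction n with
    | zero => intro a ha; simpa using ha
    | succ n ih => exact fun a ha => ih a (hnil _ (by rw [← pow_mul, ← pow_succ, ha]))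
  refine ⟨fun a ⟨n, hn⟩ => hpow n a ?_⟩
  exact pow_eq_zero_of_le (Nat.lt_pow_self (Fact.out : p.Prime).one_lt).le hn

end Commutativity

/-! ### Integrals and skew-primitive elements -/

section SkewDerivation

open Coalgebra WithConv

/-- The trivial module of a semisimple algebra splits off, which gives a normalized left
integral. -/
theorem exists_integral {k A : Type*} [Field k] [Ring A] [Algebra k A] [Coalgebra k A]
    [IsCoaugmented k A] (hmul : ∀ a b : A, (counit (a * b) : k) = counit a * counit b)
    [IsSemisimpleRing A] :
    ∃ Λ : A, (∀ a, a * Λ = (counit a : k) • Λ) ∧ (counit Λ : k) = 1 := by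
  let I : Ideal A :=
    { carrier := {a | (counit a : k) = 0}
      add_mem' := fun {a b} ha hb => by
        rw [Set.mem_ofPred_eq] at ha hb ⊢
        rw [map_add, ha, hb, add_zero]
      zero_mem' := map_zero _
      smul_mem' := fun r a ha => by
        rw [Set.mem_ofPred_eq] at ha ⊢
        rw [smul_eq_mul, hmul, ha, mul_zero] }
  obtain ⟨C, hC⟩ := exists_isCompl I
  obtain ⟨e, he, Λ, hΛ, heΛ⟩ := Submodule.mem_sup.mp
    (hC.sup_eq_top ▸ Submodule.mem_top : (1 : A) ∈ I ⊔ C)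
  have he' : (counit e : k) = 0 := he
  have hε : (counit Λ : k) = 1 := by
    have := congrArg (counit (R := k)) heΛ
    rwa [map_add, he', zero_add, counit_one_eq] at this
  refine ⟨Λ, fun a => ?_, hε⟩
  rw [← sub_eq_zero]
  refine Submodule.disjoint_def.mp hC.disjoint _ ?_ ?_
  · change (counit (a * Λ - (counit a : k) • Λ) : k) = 0
    rw [map_sub, map_smul, hmul, smul_eq_mul, sub_self]
  · refine C.sub_mem (C.smul_mem a hΛ) ?_
    rw [← one_mul Λ, ← smul_mul_assoc]
    exact C.smul_mem _ hΛ

variable {k A : Type*} [Field k] [Ring A] [Algebra k A] [Coalgebra k A] [IsCoaugmented k A]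

/-- Let `u` be a (skew-)primitive element of a conilpotent coalgebra with multiplication. If `u`
kills an element `Λ` with `ε(Λ) ≠ 0`, then `u² q = 0` implies `u q = 0` for `q` commuting with `u`.

The transpose `∂` of left multiplication by `u` is a skew derivation of the dual algebra. If
`u q ≠ 0`, some element `c = ∂ f` in the image of `∂` does not vanish at `1`, so it is invertible,
and `∂ c = 0`. Then `∂ (c⁻¹) = 0` and `ε = ∂ (f * c⁻¹)`, so that `ε(Λ) = (f * c⁻¹)(u Λ) = 0`. -/
theorem mul_eq_zero_of_mul_mul_eq_zero (hA : IsConilpotent k A) (σ : A →ₗ[k] A) (hσ : σ 1 = 1)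
    {u q Λ : A}
    (hu : ∀ a, (comul (u * a) : A ⊗[k] A) =
      TensorProduct.map (LinearMap.mulLeft k u) LinearMap.id (comul a) +
        TensorProduct.map σ (LinearMap.mulLeft k u) (comul a))
    (hεu : ∀ a, (counit (u * a) : k) = 0) (hΛ : u * Λ = 0) (hεΛ : (counit Λ : k) ≠ 0)
    (hq : Commute u q) (h2 : u * (u * q) = 0) : u * q = 0 := by
  by_contra hz
  obtain ⟨y, hy⟩ : ∃ y : A →ₗ[k] k, y (u * q) ≠ 0 := by
    by_contra! h
    exact hz ((Module.forall_dual_apply_eq_zero_iff k _).mp h)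
  let D : WithConv (A →ₗ[k] k) → WithConv (A →ₗ[k] k) := fun f =>
    toConv (f.ofConv ∘ₗ LinearMap.mulLeft k u)
  have hDmul : ∀ f g, D (f * g) = D f * g + toConv (f.ofConv ∘ₗ σ) * D g := by
    intro f g
    refine WithConv.ext (LinearMap.ext fun a => ?_)
    change (f * g) (u * a) = (D f * g) a + (toConv (f.ofConv ∘ₗ σ) * D g) a
    rw [LinearMap.convMul_apply, LinearMap.convMul_apply, LinearMap.convMul_apply, hu, map_add,
      map_add, ← LinearMap.comp_apply (TensorProduct.map f.ofConv g.ofConv),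
      ← TensorProduct.map_comp, ← LinearMap.comp_apply (TensorProduct.map f.ofConv g.ofConv),
      ← TensorProduct.map_comp]
    rfl
  let c : WithConv (A →ₗ[k] k) := toConv (y ∘ₗ LinearMap.mulLeft k (u * q))
  let f : WithConv (A →ₗ[k] k) := toConv (y ∘ₗ LinearMap.mulLeft k q)
  have hDf : D f = c := by
    refine WithConv.ext (LinearMap.ext fun a => ?_)
    change y (q * (u * a)) = y (u * q * a)
    rw [hq.eq, mul_assoc]
  have hDc : D c = 0 := by
    refine WithConv.ext (LinearMap.ext fun a => ?_)
    change y (u * q * (u * a)) = 0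
    rw [← mul_assoc, mul_assoc u q u, ← hq.eq, h2, zero_mul, map_zero]
  have hD1 : D 1 = 0 := WithConv.ext (LinearMap.ext fun a => hεu a)
  have hc1 : c 1 ≠ 0 := by
    change y (u * q * 1) ≠ 0
    rwa [mul_one]
  obtain ⟨b, hcb⟩ := (isUnit_of_apply_one_ne_zero hA hc1).exists_right_inv
  have hσc : IsUnit (toConv (c.ofConv ∘ₗ σ)) := isUnit_of_apply_one_ne_zero hA (by
    change c (σ 1) ≠ 0
    rwa [hσ])
  have hDb : D b = 0 := by
    have := hDmul c b
    rw [hcb, hD1, hDc, zero_mul, zero_add] at this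
    exact (hσc.mul_right_eq_zero).mp this.symm
  have h1 : D (f * b) = 1 := by rw [hDmul, hDf, hDb, mul_zero, add_zero, hcb]
  refine hεΛ ?_
  have h3 : D (f * b) Λ = (1 : WithConv (A →ₗ[k] k)) Λ := by rw [h1]
  change (f * b) (u * Λ) = counit Λ at h3
  rw [← h3, hΛ, map_zero]

end SkewDerivation

/-! ### Hochschild's theorem for primitive elements -/

section Hochschild

open Coalgebra

variable {K B : Type*} [Field K] [Ring B] [Bialgebra K B] (p : ℕ)

theorem eq_zero_of_pow_eq_zero_of_mem_primitives (hB : IsConilpotent K B) {Λ : B}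
    (hΛ : ∀ a, a * Λ = (counit a : K) • Λ) (hεΛ : (counit Λ : K) = 1) {u : B}
    (hu : u ∈ primitives K B) {n : ℕ} (hn : u ^ n = 0) : u = 0 := by
  have hεu := counit_eq_zero_of_mem_primitives hu
  induction n with
  | zero =>
    rw [pow_zero] at hn
    rw [← one_mul u, hn, zero_mul]
  | succ n ih =>
    rcases n with _ | n
    · simpa using hn
    refine ih ?_
    rw [pow_succ']
    refine mul_eq_zero_of_mul_mul_eq_zero hB LinearMap.id rfl (Λ := Λ) (fun a => ?_) (fun a => ?_)
      ?_ (by rw [hεΛ]; exact one_ne_zero) (Commute.self_pow u n) ?_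
    · rw [Bialgebra.comul_mul, comul_of_mem_primitives hu, add_mul, add_comm]
      have hl : ∀ t : B ⊗[K] B, u ⊗ₜ[K] 1 * t =
          TensorProduct.map (LinearMap.mulLeft K u) LinearMap.id t := fun t => by
        induction t with
        | zero => simp
        | tmul x y => simp
        | add s t hs ht => rw [mul_add, hs, ht, map_add]
      have hr : ∀ t : B ⊗[K] B, 1 ⊗ₜ[K] u * t =
          TensorProduct.map LinearMap.id (LinearMap.mulLeft K u) t := fun t => by
        induction t with
        | zero => simp
        | tmul x y => simp
        | add s t hs ht => rw [mul_add, hs, ht, map_add]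
      rw [hl, hr]
    · rw [Bialgebra.counit_mul, hεu, zero_mul]
    · rw [hΛ, hεu, zero_smul]
    · rw [← pow_succ', ← pow_succ', hn]

theorem pow_finrank_eq_zero_of_eigenvalue_eq_zero {V : Type*} [AddCommGroup V] [Module K V]
    [FiniteDimensional K V] [IsAlgClosed K] (f : Module.End K V)
    (h : ∀ μ, f.HasEigenvalue μ → μ = 0) : f ^ Module.finrank K V = 0 := by
  have hroots : f.charpoly.roots = Multiset.replicate (Module.finrank K V) 0 := by
    rw [Multiset.eq_replicate]
    refine ⟨?_, fun μ hμ => h μ ?_⟩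
    · rw [← f.charpoly_natDegree]
      exact (IsAlgClosed.splits f.charpoly).natDegree_eq_card_roots.symm
    · rw [Module.End.hasEigenvalue_iff_isRoot_charpoly]
      exact (Polynomial.mem_roots f.charpoly_monic.ne_zero).mp hμ
  have hchar : f.charpoly = Polynomial.X ^ Module.finrank K V := by
    rw [(IsAlgClosed.splits f.charpoly).eq_prod_roots_of_monic f.charpoly_monic, hroots]
    simp
  have := f.aeval_self_charpoly
  rwa [hchar, map_pow, Polynomial.aeval_X] at this

theorem mul_sub_mul_mem_primitives_of_mem {u v : B} (hu : u ∈ primitives K B)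
    (hv : v ∈ primitives K B) : u * v - v * u ∈ primitives K B := by
  have h0 : ∀ a ∈ primFiltration K B 0, ∀ b : B, Commute a b := fun a ha b => by
    rw [(Submodule.mem_bot K).mp ha]
    exact Commute.zero_left b
  rw [← primFiltration_one] at hu hv
  exact mul_sub_mul_mem_primitives (fun a ha b _ => h0 a ha b) (fun a _ b hb => (h0 b hb a).symm)
    (fun a ha b _ => h0 a ha b) hu hv

theorem commute_of_mem_adjoin_singleton {R A : Type*} [CommRing R] [Ring A] [Algebra R A]
    {u a b : A} (ha : a ∈ Algebra.adjoin R {u}) (hb : b ∈ Algebra.adjoin R {u}) : Commute a b :=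
  Algebra.commute_of_mem_adjoin_singleton_of_commute hb
    (Algebra.commute_of_mem_adjoin_self ha).symm

variable [Fact p.Prime] [CharP K p] [PerfectRing K p] [CharP B p] [CharP (B ⊗[K] B) p]
  [FiniteDimensional K B]

/-- If there are no `p`-nilpotent primitive elements, every primitive element is a `p`-th power of
a primitive element that is a polynomial in it. -/
theorem exists_primitive_pow_char_eq (hinj : ∀ u ∈ primitives K B, u ^ p = 0 → u = 0) {u : B}
    (hu : u ∈ primitives K B) : ∃ x ∈ primitives K B, x ∈ Algebra.adjoin K {u} ∧ x ^ p = u := by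
  obtain ⟨x, ⟨hx, hx'⟩, h⟩ := exists_pow_char_eq_of_mem p
    (W := primitives K B ⊓ Subalgebra.toSubmodule (Algebra.adjoin K {u}))
    (fun a ha b hb => commute_of_mem_adjoin_singleton ha.2 hb.2)
    (fun a ha => ⟨pow_char_mem_primitives p ha.1,
      (Algebra.adjoin K {u}).pow_mem ((Algebra.adjoin K {u}).mem_toSubmodule.mp ha.2) p⟩)
    (fun a ha => hinj a ha.1)
    (y := u) ⟨hu, Algebra.subset_adjoin rfl⟩
  exact ⟨x, hx, hx', h⟩

theorem commute_of_mul_sub_mul_mem_adjoin (hinj : ∀ u ∈ primitives K B, u ^ p = 0 → u = 0)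
    {u v : B} (hv : v ∈ primitives K B) (h : v * u - u * v ∈ Algebra.adjoin K {v}) :
    Commute v u := by
  obtain ⟨x, -, hx, rfl⟩ := exists_primitive_pow_char_eq p hinj hv
  have hmem : ∀ y ∈ Algebra.adjoin K {x ^ p}, y * u - u * y ∈ Algebra.adjoin K {x ^ p} := by
    intro y hy
    induction hy using Algebra.adjoin_induction with
    | mem y hy => rwa [Set.mem_singleton_iff.mp hy]
    | algebraMap r => rw [Algebra.commutes, sub_self]; exact zero_mem _
    | add a b _ _ ha hb =>
      rw [add_mul, mul_add, add_sub_add_comm]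
      exact add_mem ha hb
    | mul a b hma hmb ha hb =>
      have : a * b * u - u * (a * b) = a * (b * u - u * b) + (a * u - u * a) * b := by noncomm_ring
      rw [this]
      exact add_mem (mul_mem hma hb) (mul_mem ha hmb)
  exact commute_pow_char p (commute_of_mem_adjoin_singleton hx (hmem x hx))

/-- **Hochschild's theorem**: over an algebraically closed field, the primitive elements commute
as soon as none of them is `p`-nilpotent. An eigenvector for a nonzero eigenvalue of `ad u` would
commute with `u`, so `ad u` is nilpotent for all `u`; as every primitive element is a `pⁿ`-th
power for all `n`, it follows that `ad u = 0`. -/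
theorem commute_primitives_of_pow_char [IsAlgClosed K]
    (hinj : ∀ u ∈ primitives K B, u ^ p = 0 → u = 0) :
    ∀ u ∈ primitives K B, ∀ v ∈ primitives K B, Commute u v := by
  let ad : B → Module.End K B := fun u => LinearMap.mulLeft K u - LinearMap.mulRight K u
  have had : ∀ u v, ad u v = u * v - v * u := fun u v => rfl
  have hP : ∀ u ∈ primitives K B, ∀ v ∈ primitives K B, ad u v ∈ primitives K B := fun u hu v hv =>
    mul_sub_mul_mem_primitives_of_mem hu hv
  have hnil : ∀ u ∈ primitives K B, ∀ v ∈ primitives K B,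
      (ad u ^ Module.finrank K (primitives K B)) v = 0 := by
    intro u hu v hv
    have h0 := pow_finrank_eq_zero_of_eigenvalue_eq_zero ((ad u).restrict (hP u hu)) (by
      intro μ hμ
      obtain ⟨w, hw⟩ := hμ.exists_hasEigenvector
      have hw' : u * w - w * u = μ • (w : B) := congrArg Subtype.val hw.apply_eq_smul
      have hcomm : Commute (w : B) u := commute_of_mul_sub_mul_mem_adjoin p hinj w.2 (by
        rw [← neg_sub, hw']
        exact (Algebra.adjoin K {(w : B)}).neg_mem
          (Subalgebra.smul_mem _ (Algebra.self_mem_adjoin_singleton K (w : B)) μ))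
      rw [hcomm.eq, sub_self] at hw'
      exact (smul_eq_zero.mp hw'.symm).resolve_right fun h => hw.2 (Subtype.ext h))
    rw [Module.End.pow_restrict] at h0
    exact congrArg Subtype.val (LinearMap.congr_fun h0 ⟨v, hv⟩)
  have hroot : ∀ (n : ℕ), ∀ u ∈ primitives K B, ∃ x ∈ primitives K B, x ^ p ^ n = u := by
    intro n
    induction n with
    | zero => exact fun u hu => ⟨u, hu, by simp⟩
    | succ n ih =>
      intro u hu
      obtain ⟨y, hy, hyu⟩ := ih u hu
      obtain ⟨x, hx, -, hxy⟩ := exists_primitive_pow_char_eq p hinj hy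
      exact ⟨x, hx, by rw [pow_succ', pow_mul, hxy, hyu]⟩
  intro u hu v hv
  obtain ⟨x, hx, rfl⟩ := hroot (Module.finrank K (primitives K B)) u hu
  have : Nontrivial B := CharP.nontrivial_of_char_ne_one (Fact.out : p.Prime).ne_one
  have : CharP (Module.End K B) p :=
    charP_of_injective_algebraMap (FaithfulSMul.algebraMap_injective K (Module.End K B)) p
  have hpow : ad (x ^ p ^ Module.finrank K (primitives K B)) =
      ad x ^ p ^ Module.finrank K (primitives K B) := by
    simp only [ad]
    rw [sub_pow_char_pow_of_commute p _ (LinearMap.commute_mulLeft_right x x),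
      LinearMap.pow_mulLeft, LinearMap.pow_mulRight]
  have h0 : ad (x ^ p ^ Module.finrank K (primitives K B)) v = 0 := by
    rw [hpow, ← Nat.sub_add_cancel (Nat.lt_pow_self (n := Module.finrank K (primitives K B))
      (Fact.out : p.Prime).one_lt).le, pow_add, Module.End.mul_apply, hnil x hx v hv, map_zero]
  rw [had] at h0
  exact sub_eq_zero.mp h0

end Hochschild

/-! ### Function algebras of `p`-groups -/

section Split

open Coalgebra WithConv

variable {K B : Type*} [Field K] [CommRing B]

theorem exists_algHom_apply_ne_zero [Algebra K B] [IsAlgClosed K] [FiniteDimensional K B]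
    [IsReduced B] {b : B} (hb : b ≠ 0) : ∃ χ : B →ₐ[K] K, χ b ≠ 0 := by
  have : IsArtinianRing B := IsArtinianRing.of_finite K B
  have hnil : b ∉ nilradical B := fun h => hb (by simpa using h)
  rw [nilradical_eq_sInf, Ideal.mem_sInf] at hnil
  push Not at hnil
  obtain ⟨M, hM, hbM⟩ := hnil
  have hM' : M.IsPrime := hM
  have hmax : M.IsMaximal := IsArtinianRing.isMaximal_of_isPrime M
  let := Ideal.Quotient.field M
  let e : K ≃ₐ[K] B ⧸ M := AlgEquiv.ofBijective (Algebra.ofId K (B ⧸ M))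
    IsAlgClosed.algebraMap_bijective_of_isIntegral
  refine ⟨(e.symm : (B ⧸ M) →ₐ[K] K).comp (Ideal.Quotient.mkₐ K M), fun h => hbM ?_⟩
  have h' : e.symm (Ideal.Quotient.mk M b) = 0 := h
  exact Ideal.Quotient.eq_zero_iff_mem.mp ((map_eq_zero_iff e.symm e.symm.injective).mp h')

/-- A finite-dimensional reduced commutative algebra over an algebraically closed field is the
algebra of functions on its set of characters. -/
theorem bijective_eval_algHom [Algebra K B] [IsAlgClosed K] [FiniteDimensional K B]
    [IsReduced B] : Function.Bijective fun (b : B) (χ : B →ₐ[K] K) => χ b := by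
  have : Fintype (B →ₐ[K] K) := Fintype.ofFinite _
  let ev : B →ₗ[K] ((B →ₐ[K] K) → K) := LinearMap.pi fun χ => χ.toLinearMap
  have hinj : Function.Injective ev := by
    rw [injective_iff_map_eq_zero]
    intro b hb
    by_contra hne
    obtain ⟨χ, hχ⟩ := exists_algHom_apply_ne_zero (K := K) hne
    exact hχ (congrFun hb χ)
  have hli : LinearIndependent K (AlgHom.toLinearMap : (B →ₐ[K] K) → B →ₗ[K] K) :=
    linearIndependent_algHom_toLinearMap K B K
  have hle : Fintype.card (B →ₐ[K] K) ≤ Module.finrank K B := by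
    rw [← Subspace.dual_finrank_eq]
    exact hli.fintype_card_le_finrank
  have hge : Module.finrank K B ≤ Fintype.card (B →ₐ[K] K) := by
    rw [← Module.finrank_fintype_fun_eq_card K (η := B →ₐ[K] K)]
    exact LinearMap.finrank_le_finrank_of_injective hinj
  have heq : Module.finrank K B = Module.finrank K ((B →ₐ[K] K) → K) := by
    rw [Module.finrank_fintype_fun_eq_card]
    exact le_antisymm hge hle
  exact ⟨hinj, (LinearMap.injective_iff_surjective_of_finrank_eq_finrank heq).mp hinj⟩

variable [Bialgebra K B]

/-- If the characters of a bialgebra `B` separate and exhaust functions, and form a group `G`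
under convolution, then `B` is the function algebra of `G`. -/
theorem exists_equiv_functionAlgebra {G : Type*} [Group G] [Fintype G]
    (φ : G ≃* WithConv (B →ₐ[K] K))
    (hbij : Function.Bijective fun (b : B) (χ : B →ₐ[K] K) => χ b) :
    ∃ e : B ≃ₐ[K] FunctionAlgebra K G, (∀ b, (counit (e b) : K) = counit b) ∧
      ∀ b, (comul (e b) : FunctionAlgebra K G ⊗[K] FunctionAlgebra K G) =
        TensorProduct.map e.toLinearMap e.toLinearMap (comul b) := by
  let f : B →ₐ[K] FunctionAlgebra K G := AlgHom.ofLinearMap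
    (show B →ₗ[K] (G → K) from LinearMap.pi fun g => (φ g).ofConv.toLinearMap)
    (funext fun g => map_one (φ g).ofConv) fun a b => funext fun g => map_mul (φ g).ofConv a b
  have hf : ∀ b g, f b g = (φ g).ofConv b := fun b g => rfl
  have hfbij : Function.Bijective f := by
    refine ⟨fun a b hab => hbij.1 (funext fun χ => ?_), fun y => ?_⟩
    · have := congrFun hab (φ.symm (toConv χ))
      rwa [hf, hf, MulEquiv.apply_symm_apply] at this
    · obtain ⟨b, hb⟩ := hbij.2 fun χ => y (φ.symm (toConv χ))
      refine ⟨b, funext fun g => ?_⟩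
      rw [hf, show (φ g).ofConv b = _ from congrFun hb _, toConv_ofConv, MulEquiv.symm_apply_apply]
  refine ⟨AlgEquiv.ofBijective f hfbij, fun b => ?_, fun b => ?_⟩
  · change f b 1 = _
    rw [hf, map_one]
    rfl
  · change comul (f b) = TensorProduct.map f.toLinearMap f.toLinearMap (comul b)
    have key : ∀ t : B ⊗[K] B, TensorProduct.map f.toLinearMap f.toLinearMap t =
        ∑ a : G, ∑ c : G,
          Algebra.TensorProduct.lift (φ a).ofConv (φ c).ofConv (fun _ _ => .all ..) t •
            (FunctionAlgebra.delta K a ⊗ₜ[K] FunctionAlgebra.delta K c) := by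
      intro t
      induction t with
      | zero => simp
      | tmul x y =>
        rw [TensorProduct.map_tmul]
        conv_lhs => rw [← FunctionAlgebra.sum_apply_smul_delta K (f.toLinearMap x),
          ← FunctionAlgebra.sum_apply_smul_delta K (f.toLinearMap y)]
        rw [TensorProduct.sum_tmul]
        refine Finset.sum_congr rfl fun a _ => ?_
        rw [TensorProduct.tmul_sum]
        refine Finset.sum_congr rfl fun c _ => ?_
        rw [TensorProduct.smul_tmul_smul, Algebra.TensorProduct.lift_tmul]
        rfl
      | add s t hs ht =>
        rw [map_add, hs, ht, ← Finset.sum_add_distrib]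
        refine Finset.sum_congr rfl fun a _ => ?_
        rw [← Finset.sum_add_distrib]
        exact Finset.sum_congr rfl fun c _ => by rw [map_add, add_smul]
    rw [key, FunctionAlgebra.comul_apply]
    refine Finset.sum_congr rfl fun a _ => Finset.sum_congr rfl fun c _ => ?_
    rw [hf, map_mul, ← AlgHom.convMul_apply]

variable (p : ℕ) [Fact p.Prime] [CharP K p]

/-- Characters of a conilpotent bialgebra in characteristic `p` have `p`-power order: `χ - ε`
vanishes at `1`, so it is nilpotent in the dual algebra. -/
theorem exists_pow_eq_one_of_isConilpotent (hB : IsConilpotent K B) (χ : WithConv (B →ₐ[K] K)) :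
    ∃ n, χ ^ p ^ n = 1 := by
  let f : WithConv (B →ₗ[K] K) := toConv χ.ofConv.toLinearMap
  have hone : (1 : WithConv (B →ₗ[K] K)) 1 = 1 := by simp
  have : Nontrivial (WithConv (B →ₗ[K] K)) :=
    ⟨0, 1, fun h => zero_ne_one (α := K) (by rw [← hone, ← h]; rfl)⟩
  have : CharP (WithConv (B →ₗ[K] K)) p :=
    charP_of_injective_algebraMap (FaithfulSMul.algebraMap_injective K (WithConv (B →ₗ[K] K))) p
  obtain ⟨n, hn⟩ : IsNilpotent (f - 1) := isNilpotent_of_apply_one_eq_zero hB (by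
    change χ.ofConv 1 - (1 : WithConv (B →ₗ[K] K)) 1 = 0
    rw [map_one, hone, sub_self])
  refine ⟨n, ?_⟩
  have h1 : f ^ p ^ n = 1 := by
    rw [← sub_eq_zero, ← one_pow (M := WithConv (B →ₗ[K] K)) (p ^ n),
      ← sub_pow_char_pow_of_commute p n (Commute.one_right f)]
    exact pow_eq_zero_of_le (Nat.lt_pow_self (Fact.out : p.Prime).one_lt).le hn
  refine WithConv.ofConv_injective (AlgHom.toLinearMap_injective (WithConv.toConv_injective ?_))
  rw [AlgHom.toLinearMap_convPow, AlgHom.toLinearMap_convOne]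
  exact h1

/-- The group is the group of characters under convolution. It is transported to `Type` by
`Shrink`, which is possible because it is finite. -/
theorem exists_pGroup_functionAlgebra [IsAlgClosed K] [FiniteDimensional K B] [IsReduced B]
    (hB : IsConilpotent K B) :
    ∃ (G : Type) (_ : Group G) (_ : Fintype G), IsPGroup p G ∧
      ∃ e : B ≃ₐ[K] FunctionAlgebra K G, (∀ b, (counit (e b) : K) = counit b) ∧
        ∀ b, (comul (e b) : FunctionAlgebra K G ⊗[K] FunctionAlgebra K G) =
          TensorProduct.map e.toLinearMap e.toLinearMap (comul b) := by
  have hpow := exists_pow_eq_one_of_isConilpotent p hB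
  have : Finite (WithConv (B →ₐ[K] K)) := Finite.of_equiv _ (WithConv.equiv _).symm
  let : Group (WithConv (B →ₐ[K] K)) := groupOfIsUnit fun χ => by
    obtain ⟨n, hn⟩ := hpow χ
    exact IsUnit.of_pow_eq_one hn (pow_ne_zero n (Fact.out : p.Prime).ne_zero)
  have : Finite (Shrink.{0} (WithConv (B →ₐ[K] K))) := Finite.of_equiv _ (equivShrink _)
  let φ : Shrink.{0} (WithConv (B →ₐ[K] K)) ≃* WithConv (B →ₐ[K] K) := Shrink.mulEquiv
  let : Fintype (Shrink.{0} (WithConv (B →ₐ[K] K))) := Fintype.ofFinite _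
  refine ⟨Shrink.{0} (WithConv (B →ₐ[K] K)), inferInstance, inferInstance, fun g => ?_,
    exists_equiv_functionAlgebra φ bijective_eval_algHom⟩
  obtain ⟨m, hm⟩ := hpow (φ g)
  exact ⟨m, φ.injective (by rw [map_pow, hm, map_one])⟩

end Split

/-! ### Extension of scalars -/

section BaseChange

open Coalgebra TensorProduct.AlgebraTensorModule

variable {k A : Type*} (K : Type*) [Field k] [Field K] [Algebra k K] [Ring A] [Bialgebra k A]

/-- Reduced comultiplication is compatible with extension of scalars, up to the identification
`K ⊗ (A ⊗ A) = (K ⊗ A) ⊗ (K ⊗ A)`. -/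
theorem reducedComul_baseChange :
    reducedComul K (K ⊗[k] A) =
      (distribBaseChange k K A A).toLinearMap ∘ₗ (reducedComul k A).baseChange K := by
  ext a
  have h : ∀ t : A ⊗[k] A, tensorTensorTensorComm k K k K K K A A ((1 ⊗ₜ[K] 1) ⊗ₜ[k] t) =
      distribBaseChange k K A A (1 ⊗ₜ[k] t) := by
    intro t
    induction t with
    | zero => simp only [TensorProduct.tmul_zero, map_zero]
    | tmul x y => rfl
    | add s t hs ht => rw [TensorProduct.tmul_add, TensorProduct.tmul_add, map_add, map_add, hs, ht]
  simp only [TensorProduct.AlgebraTensorModule.curry_apply,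
    TensorProduct.curry_apply, LinearMap.coe_restrictScalars, LinearMap.comp_apply,
    LinearEquiv.coe_coe, LinearMap.baseChange_tmul, reducedComul_apply, TensorProduct.comul_tmul,
    CommSemiring.comul_apply, h, TensorProduct.tmul_sub, map_sub, distribBaseChange_tmul]
  rfl

theorem baseChange_primFiltration_le (n : ℕ) :
    (primFiltration k A n).baseChange K ≤ primFiltration K (K ⊗[k] A) n := by
  induction n with
  | zero => rw [primFiltration_zero, primFiltration_zero, Submodule.baseChange_bot]
  | succ n ih =>
    rw [Submodule.baseChange_eq_span, Submodule.span_le]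
    rintro _ ⟨a, ha, rfl⟩
    change (1 : K) ⊗ₜ[k] a ∈ primFiltration K (K ⊗[k] A) (n + 1)
    rw [mem_primFiltration_succ, reducedComul_baseChange]
    change distribBaseChange k K A A (1 ⊗ₜ[k] reducedComul k A a) ∈ _
    refine tensorSquare_induction (motive := fun t =>
      distribBaseChange k K A A (1 ⊗ₜ[k] t) ∈ tensorSquare (primFiltration K (K ⊗[k] A) n))
      ?_ (fun x hx y hy => ?_) (fun s t hs ht => ?_) (mem_primFiltration_succ.mp ha)
    · rw [TensorProduct.tmul_zero, map_zero]
      exact zero_mem _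
    · exact tmul_mem_tensorSquare (ih (Submodule.tmul_mem_baseChange_of_mem _ hx))
        (ih (Submodule.tmul_mem_baseChange_of_mem _ hy))
    · rw [TensorProduct.tmul_add, map_add]
      exact add_mem hs ht

theorem IsConilpotent.baseChange (hA : IsConilpotent k A) : IsConilpotent K (K ⊗[k] A) := by
  obtain ⟨N, hN⟩ := hA
  have key : ∀ x : K ⊗[k] A, x - algebraMap K _ (counit x) ∈ primFiltration K (K ⊗[k] A) N := by
    intro x
    induction x with
    | zero => simp
    | tmul c a =>
      have h : c ⊗ₜ[k] a - algebraMap K (K ⊗[k] A) (counit (c ⊗ₜ[k] a)) =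
          c ⊗ₜ[k] (a - algebraMap k A (counit a)) := by
        rw [TensorProduct.tmul_sub, TensorProduct.counit_tmul, Algebra.TensorProduct.algebraMap_apply,
          Algebra.algebraMap_eq_smul_one (A := A), TensorProduct.tmul_smul, TensorProduct.smul_tmul']
        rfl
      rw [h]
      exact baseChange_primFiltration_le K N
        (Submodule.tmul_mem_baseChange_of_mem _ (sub_algebraMap_counit_mem hN a))
    | add x y hx hy =>
      rw [map_add, map_add, add_sub_add_comm]
      exact add_mem hx hy
  refine ⟨N, fun x hx => ?_⟩
  have := key x
  rwa [hx, map_zero, sub_zero] at this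

/-- Primitive elements form a kernel, and `K` is flat over `k`. -/
theorem primitives_baseChange_le :
    primitives K (K ⊗[k] A) ≤ (primitives k A).baseChange K := by
  intro x hx
  rw [mem_primitives_iff, reducedComul_baseChange] at hx
  have hx' : x ∈ LinearMap.ker (lTensor K K (reducedComul k A)) :=
    LinearMap.mem_ker.mpr ((LinearEquiv.map_eq_zero_iff (distribBaseChange k K A A)).mp hx)
  rw [Module.Flat.ker_lTensor_eq K K (reducedComul k A)] at hx'
  have hker : LinearMap.ker (reducedComul k A) = primitives k A := by
    ext a
    rw [LinearMap.mem_ker, mem_primitives_iff]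
  rw [← hker]
  exact hx'

theorem exists_integral_baseChange {Λ : A} (hΛ : ∀ a, a * Λ = (counit a : k) • Λ)
    (hε : (counit Λ : k) = 1) :
    (∀ x : K ⊗[k] A, x * (1 ⊗ₜ[k] Λ) = (counit x : K) • ((1 : K) ⊗ₜ[k] Λ)) ∧
      (counit ((1 : K) ⊗ₜ[k] Λ) : K) = 1 := by
  refine ⟨fun x => ?_, by simp [hε]⟩
  induction x with
  | zero => simp
  | tmul c a =>
    rw [Algebra.TensorProduct.tmul_mul_tmul, hΛ, mul_one, TensorProduct.counit_tmul,
      TensorProduct.tmul_smul, TensorProduct.smul_tmul', TensorProduct.smul_tmul']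
    simp
  | add x y hx hy => rw [add_mul, hx, hy, map_add, add_smul]

end BaseChange

/-! ### Minimal polynomials of primitive elements -/

section Separable

open Coalgebra Polynomial

theorem nontrivial_of_isCoaugmented (k A : Type*) [Field k] [Ring A] [Algebra k A] [Coalgebra k A]
    [IsCoaugmented k A] : Nontrivial A :=
  ⟨0, 1, fun h => zero_ne_one (α := k) (by rw [← counit_one_eq (A := A) k, ← h, map_zero])⟩

theorem natDegree_minpoly_le {k A : Type*} [Field k] [Ring A] [Algebra k A] {u : A} {q : k[X]}
    (hq : q ≠ 0) (h : aeval u q = 0) : (minpoly k u).natDegree ≤ q.natDegree :=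
  natDegree_le_natDegree (minpoly.degree_le_of_ne_zero k u hq h)

variable {k A : Type*} [Field k] [Ring A] [Bialgebra k A]

/-- A functional that reads off the coefficient of `u` in polynomials in `u` below the degree of its
minimal polynomial. -/
theorem exists_dual_pow_eq (u : A) :
    ∃ ψ : A →ₗ[k] k, ∀ i < (minpoly k u).natDegree, ψ (u ^ i) = if i = 1 then 1 else 0 := by
  obtain ⟨g, hg⟩ := LinearMap.exists_leftInverse_of_injective _
    (LinearMap.ker_eq_bot.mpr (linearIndependent_pow (K := k) u))
  refine ⟨Finsupp.lsum k (fun i : Fin (minpoly k u).natDegree =>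
    if (i : ℕ) = 1 then LinearMap.id else 0) ∘ₗ g, fun i hi => ?_⟩
  have := LinearMap.congr_fun hg (Finsupp.single ⟨i, hi⟩ 1)
  rw [LinearMap.comp_apply, Finsupp.linearCombination_single, one_smul] at this
  rw [LinearMap.comp_apply, this]
  simp only [LinearMap.id_apply, Finsupp.lsum_single]
  split_ifs <;> simp

variable [FiniteDimensional k A]

/-- The minimal polynomial of a primitive element has constant derivative. It is in fact additive:
`Δ` maps `u` to `u ⊗ 1 + 1 ⊗ u`. The derivative arises by applying to `Δ` a functional on the
second factor that vanishes on all powers of `u` below the degree, except on `u` itself. -/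
theorem derivative_minpoly_of_mem_primitives {u : A} (hu : u ∈ primitives k A) :
    ∃ c : k, derivative (minpoly k u) = C c := by
  have : Nontrivial A := nontrivial_of_isCoaugmented k A
  set f := minpoly k u with hf
  set d := f.natDegree with hd
  have hint : IsIntegral k u := Algebra.IsIntegral.isIntegral u
  have hd0 : 0 < d := minpoly.natDegree_pos hint
  rcases Nat.lt_or_ge 1 d with hd1 | hd1
  swap
  · exact ⟨_, eq_C_of_natDegree_eq_zero (by
      have := natDegree_derivative_le f
      omega)⟩
  obtain ⟨ψ, hψ⟩ : ∃ ψ : A →ₗ[k] k, ∀ i < d, ψ (u ^ i) = if i = 1 then 1 else 0 :=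
    exists_dual_pow_eq u
  have hψ0 : ψ 1 = 0 := by simpa using hψ 0 hd0
  have hψ1 : ψ u = 1 := by simpa using hψ 1 hd1
  let θ : A →ₗ[k] A := (TensorProduct.rid k A).toLinearMap ∘ₗ ψ.lTensor A ∘ₗ comul
  have hθ : ∀ j ≤ d, θ (u ^ j) = (j : k) • u ^ (j - 1) + (if j = d then ψ (u ^ d) else 0) • 1 := by
    intro j hj
    have hexp : θ (u ^ j) =
        ∑ i ∈ Finset.range (j + 1), ((j.choose i : k) * ψ (u ^ i)) • u ^ (j - i) := by
      change TensorProduct.rid k A (ψ.lTensor A (comul (u ^ j))) = _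
      rw [Bialgebra.comul_pow, comul_of_mem_primitives hu,
        (show Commute ((1 : A) ⊗ₜ[k] u) (u ⊗ₜ[k] (1 : A)) from
          (commute_tmul_one_one_tmul u u).symm).add_pow, map_sum, map_sum]
      refine Finset.sum_congr rfl fun i _ => ?_
      rw [Algebra.TensorProduct.tmul_pow, Algebra.TensorProduct.tmul_pow,
        Algebra.TensorProduct.tmul_mul_tmul, one_pow, one_pow, one_mul, mul_one,
        (Nat.cast_commute _ _).eq.symm, ← nsmul_eq_mul, map_nsmul, LinearMap.lTensor_tmul,
        map_nsmul, TensorProduct.rid_tmul, mul_smul, Nat.cast_smul_eq_nsmul]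
    rw [hexp]
    rcases hj.lt_or_eq with hlt | rfl
    · rw [if_neg hlt.ne, zero_smul, add_zero]
      rcases Nat.eq_zero_or_pos j with rfl | hj0
      · simp [hψ0]
      · rw [Finset.sum_eq_single 1]
        · simp [hψ1]
        · intro i hi hi1
          rw [hψ i (by have := Finset.mem_range.mp hi; omega), if_neg hi1, mul_zero, zero_smul]
        · intro h
          exact absurd (Finset.mem_range.mpr (by omega)) h
    · rw [if_pos rfl, Finset.sum_range_succ, Nat.sub_self, pow_zero, Nat.choose_self, Nat.cast_one,
        one_mul, Finset.sum_eq_single 1]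
      · simp [hψ1]
      · intro i hi hi1
        rw [hψ i (Finset.mem_range.mp hi), if_neg hi1, mul_zero, zero_smul]
      · intro h
        exact absurd (Finset.mem_range.mpr hd1) h
  have h0 : aeval u (derivative f) + ψ (u ^ d) • (1 : A) = 0 := by
    have h1 : θ (aeval u f) = 0 := by rw [hf, minpoly.aeval, map_zero]
    have h2 : aeval u (derivative f) =
        ∑ j ∈ Finset.range (d + 1), f.coeff j • ((j : k) • u ^ (j - 1)) := by
      conv_lhs => rw [f.as_sum_range]
      rw [derivative_sum, map_sum]
      refine Finset.sum_congr rfl fun j _ => ?_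
      rw [derivative_monomial, aeval_monomial, ← Algebra.smul_def, mul_smul]
    have h3 : ψ (u ^ d) • (1 : A) =
        ∑ j ∈ Finset.range (d + 1), f.coeff j • ((if j = d then ψ (u ^ d) else 0) • (1 : A)) := by
      rw [Finset.sum_eq_single d]
      · rw [if_pos rfl, hd, (minpoly.monic hint).coeff_natDegree, one_smul]
      · intro j _ hj
        rw [if_neg hj, zero_smul, smul_zero]
      · intro h
        exact absurd (Finset.mem_range.mpr (Nat.lt_succ_self d)) h
    rw [← h1, h2, h3, ← Finset.sum_add_distrib, aeval_eq_sum_range, map_sum]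
    refine Finset.sum_congr rfl fun j hj => ?_
    rw [map_smul, hθ j (Nat.lt_succ_iff.mp (Finset.mem_range.mp hj)), smul_add]
  have hdeg : derivative f + C (ψ (u ^ d)) = 0 := by
    by_contra hne
    have h1 : d ≤ _ := natDegree_minpoly_le hne (by
      rw [map_add (aeval u), aeval_C, Algebra.algebraMap_eq_smul_one, h0])
    have h2 : (derivative f + C (ψ (u ^ d))).natDegree ≤ d - 1 := by
      refine (natDegree_add_le _ _).trans (max_le (natDegree_derivative_le f) ?_)
      rw [natDegree_C]
      exact Nat.zero_le _
    omega
  exact ⟨-ψ (u ^ d), by rw [C_neg, eq_neg_iff_add_eq_zero, hdeg]⟩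

/-- The minimal polynomial of `u` is divisible by `X`, but not by `X ^ 2` if `k[u]` is reduced; so
its constant derivative is not zero. -/
theorem separable_minpoly_of_mem_primitives {u : A} (hu : u ∈ primitives k A)
    (hred : ∀ x ∈ Algebra.adjoin k {u}, x * x = 0 → x = 0) : (minpoly k u).Separable := by
  have hint : IsIntegral k u := Algebra.IsIntegral.isIntegral u
  have hne : minpoly k u ≠ 0 := minpoly.ne_zero hint
  have hε : ∀ q : k[X], (counit (aeval u q) : k) = q.eval 0 := by
    intro q
    have := aeval_algHom_apply (Bialgebra.counitAlgHom k A) u q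
    rw [Bialgebra.counitAlgHom_apply, Bialgebra.counitAlgHom_apply,
      counit_eq_zero_of_mem_primitives hu, ← coe_aeval_eq_eval] at *
    exact this.symm
  obtain ⟨g, hg⟩ : X ∣ minpoly k u := by
    rw [X_dvd_iff, coeff_zero_eq_eval_zero, ← hε, minpoly.aeval, map_zero]
  obtain ⟨c, hc⟩ := derivative_minpoly_of_mem_primitives hu
  have hc0 : c ≠ 0 := by
    rintro rfl
    rw [C_0, hg, derivative_mul, derivative_X, one_mul] at hc
    obtain ⟨h, rfl⟩ : X ∣ g := ⟨-derivative g, by linear_combination hc⟩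
    have hz : aeval u (X * h) = 0 := by
      refine hred _ (aeval_mem_adjoin_singleton k u) ?_
      rw [← map_mul, show X * h * (X * h) = X * (X * h) * h by ring, ← hg, map_mul, minpoly.aeval,
        zero_mul]
    have hh : X * h ≠ 0 := fun h0 => hne (by rw [hg, h0, mul_zero])
    have := natDegree_minpoly_le hh hz
    rw [hg, natDegree_X_mul hh] at this
    omega
  rw [Polynomial.Separable, hc]
  exact ⟨0, C c⁻¹, by rw [zero_mul, zero_add, ← C_mul, inv_mul_cancel₀ hc0, C_1]⟩

end Separable

/-! ### Tori after extension of scalars -/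

section Torus

open Coalgebra Polynomial

variable {k A : Type*} (K : Type*) [Field k] [Field K] [Algebra k K] [Ring A]

theorem commute_of_mem_baseChange [Algebra k A] {P : Submodule k A}
    (hcomm : ∀ u ∈ P, ∀ v ∈ P, Commute u v) {x y : K ⊗[k] A} (hx : x ∈ P.baseChange K)
    (hy : y ∈ P.baseChange K) : Commute x y := by
  rw [Submodule.baseChange_eq_span] at hx hy
  refine Submodule.span_induction₂ (p := fun x y _ _ => Commute x y) ?_
    (fun y _ => Commute.zero_left y)
    (fun x _ => Commute.zero_right x) (fun _ _ _ _ _ _ h1 h2 => h1.add_left h2)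
    (fun _ _ _ _ _ _ h1 h2 => h1.add_right h2) (fun c _ _ _ _ h => h.smul_left c)
    (fun c _ _ _ _ h => h.smul_right c) hx hy
  rintro _ _ ⟨u, hu, rfl⟩ ⟨v, hv, rfl⟩
  change (1 : K) ⊗ₜ[k] u * 1 ⊗ₜ[k] v = 1 ⊗ₜ[k] v * 1 ⊗ₜ[k] u
  rw [Algebra.TensorProduct.tmul_mul_tmul, Algebra.TensorProduct.tmul_mul_tmul,
    (hcomm u hu v hv).eq]

/-- Linear combinations of commuting elements with separable minimal polynomials act semisimply
after extension of scalars to a perfect field. -/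
theorem isSemisimple_mulLeft_of_mem_baseChange [Algebra k A] [FiniteDimensional k A]
    [PerfectField K] {P : Submodule k A} (hcomm : ∀ u ∈ P, ∀ v ∈ P, Commute u v)
    (hsep : ∀ u ∈ P, (minpoly k u).Separable) {x : K ⊗[k] A} (hx : x ∈ P.baseChange K) :
    Module.End.IsSemisimple (LinearMap.mulLeft K x) := by
  rw [Submodule.baseChange_eq_span] at hx
  induction hx using Submodule.span_induction with
  | mem x hx =>
    obtain ⟨u, hu, rfl⟩ := hx
    refine Module.End.isSemisimple_of_squarefree_aeval_eq_zero
      ((hsep u hu).map (f := algebraMap k K)).squarefree ?_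
    change aeval (Algebra.lmul K (K ⊗[k] A) (Algebra.TensorProduct.includeRight u)) _ = 0
    rw [aeval_algHom_apply, aeval_map_algebraMap, aeval_algHom_apply, minpoly.aeval, map_zero,
      map_zero]
  | zero =>
    rw [LinearMap.mulLeft_zero_eq_zero]
    exact Module.End.isSemisimple_zero
  | add x y hx hy h1 h2 =>
    rw [← Submodule.baseChange_eq_span] at hx hy
    have : LinearMap.mulLeft K (x + y) = LinearMap.mulLeft K x + LinearMap.mulLeft K y := by
      ext; simp [add_mul]
    rw [this]
    refine Module.End.IsSemisimple.add_of_commute ?_ h1 h2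
    rw [Commute, SemiconjBy, Module.End.mul_eq_comp, Module.End.mul_eq_comp,
      ← LinearMap.mulLeft_mul, ← LinearMap.mulLeft_mul, (commute_of_mem_baseChange K hcomm hx hy).eq]
  | smul c x _ h =>
    have : LinearMap.mulLeft K (c • x) = c • LinearMap.mulLeft K x := by
      ext; simp
    rw [this]
    exact Module.End.IsSemisimple_smul c h

theorem eq_zero_of_pow_eq_zero_of_mem_baseChange [Algebra k A] [FiniteDimensional k A]
    [PerfectField K] {P : Submodule k A} (hcomm : ∀ u ∈ P, ∀ v ∈ P, Commute u v)
    (hsep : ∀ u ∈ P, (minpoly k u).Separable) {x : K ⊗[k] A} (hx : x ∈ P.baseChange K)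
    {n : ℕ} (hn : x ^ n = 0) : x = 0 := by
  have h := Module.End.eq_zero_of_isNilpotent_isSemisimple
    (f := LinearMap.mulLeft K x)
    ⟨n, by rw [LinearMap.pow_mulLeft, hn, LinearMap.mulLeft_zero_eq_zero]⟩
    (isSemisimple_mulLeft_of_mem_baseChange K hcomm hsep hx)
  simpa using LinearMap.congr_fun h 1

end Torus

/-! ### Commutative semisimple algebras -/

section Descent

variable {k A : Type*} [Field k] [Ring A] [Algebra k A]

/-- Reducedness is stated by squares because `A` is not a `CommRing` instance. -/
theorem isSemisimpleRing_of_commute_of_isReduced [FiniteDimensional k A]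
    (hcomm : ∀ a b : A, a * b = b * a) (hred : ∀ a : A, a * a = 0 → a = 0) :
    IsSemisimpleRing A := by
  let : CommRing A := { ‹Ring A› with mul_comm := hcomm }
  have : IsArtinianRing A := IsArtinianRing.of_finite k A
  have : IsReduced A := isReduced_iff_pow_one_lt 2 one_lt_two |>.mpr fun a ha =>
    hred a (by rw [← sq, ha])
  exact IsArtinianRing.isSemisimpleRing_of_isReduced A

theorem eq_zero_of_mul_self_eq_zero_of_isSemisimpleRing {A : Type*} [Ring A] [IsSemisimpleRing A]
    (hcomm : ∀ a b : A, a * b = b * a) {a : A} (ha : a * a = 0) : a = 0 := by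
  let : CommRing A := { ‹Ring A› with mul_comm := hcomm }
  exact IsReduced.eq_zero a ⟨2, by rw [sq, ha]⟩

end Descent

/-! ### Bialgebras that become function algebras -/

section MainEven

open Coalgebra

variable {k A K : Type*} [Field k] [Field K] [Algebra k K] [IsAlgClosed K] [Ring A] [Bialgebra k A]
  [FiniteDimensional k A] (p : ℕ) [Fact p.Prime] [CharP K p]

/-- A conilpotent bialgebra becomes the function algebra of a `p`-group over `K` as soon as the
primitive elements over `K` commute and none of them is `p`-nilpotent. -/
theorem exists_pGroup_of_primitives (hA : IsConilpotent k A)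
    (hcomm : ∀ u ∈ primitives K (K ⊗[k] A), ∀ v ∈ primitives K (K ⊗[k] A), Commute u v)
    (hinj : ∀ u ∈ primitives K (K ⊗[k] A), u ^ p = 0 → u = 0) :
    ∃ (G : Type) (_ : Group G) (_ : Fintype G), IsPGroup p G ∧
      ∃ e : K ⊗[k] A ≃ₐ[K] FunctionAlgebra K G, (∀ b, (counit (e b) : K) = counit b) ∧
        ∀ b, (comul (e b) : FunctionAlgebra K G ⊗[K] FunctionAlgebra K G) =
          TensorProduct.map e.toLinearMap e.toLinearMap (comul b) := by
  have hAK := hA.baseChange K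
  have : Nontrivial (K ⊗[k] A) := nontrivial_of_isCoaugmented K _
  have : CharP (K ⊗[k] A) p :=
    charP_of_injective_algebraMap (FaithfulSMul.algebraMap_injective K (K ⊗[k] A)) p
  have : CharP ((K ⊗[k] A) ⊗[K] (K ⊗[k] A)) p := charP_of_injective_algebraMap
    (FaithfulSMul.algebraMap_injective K ((K ⊗[k] A) ⊗[K] (K ⊗[k] A))) p
  have hred := isReduced_of_primitives p hAK hcomm hinj
  let inst : CommRing (K ⊗[k] A) :=
    { (inferInstance : Ring (K ⊗[k] A)) with
      mul_comm := commute_of_primitives p hAK hcomm hinj }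
  exact exists_pGroup_functionAlgebra (B := K ⊗[k] A) p hAK

/-- A normalized left integral excludes `p`-nilpotent primitive elements over `K`, which makes the
primitive elements commute by Hochschild's theorem. -/
theorem exists_pGroup_of_integral (hA : IsConilpotent k A) {Λ : A}
    (hΛ : ∀ a, a * Λ = (counit a : k) • Λ) (hε : (counit Λ : k) = 1) :
    ∃ (G : Type) (_ : Group G) (_ : Fintype G), IsPGroup p G ∧
      ∃ e : K ⊗[k] A ≃ₐ[K] FunctionAlgebra K G, (∀ b, (counit (e b) : K) = counit b) ∧
        ∀ b, (comul (e b) : FunctionAlgebra K G ⊗[K] FunctionAlgebra K G) =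
          TensorProduct.map e.toLinearMap e.toLinearMap (comul b) := by
  have : Nontrivial (K ⊗[k] A) := nontrivial_of_isCoaugmented K _
  have : CharP (K ⊗[k] A) p :=
    charP_of_injective_algebraMap (FaithfulSMul.algebraMap_injective K (K ⊗[k] A)) p
  have : CharP ((K ⊗[k] A) ⊗[K] (K ⊗[k] A)) p := charP_of_injective_algebraMap
    (FaithfulSMul.algebraMap_injective K ((K ⊗[k] A) ⊗[K] (K ⊗[k] A))) p
  obtain ⟨hΛK, hεK⟩ := exists_integral_baseChange K hΛ hε
  have hinj : ∀ u ∈ primitives K (K ⊗[k] A), u ^ p = 0 → u = 0 := fun u hu h0 =>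
    eq_zero_of_pow_eq_zero_of_mem_primitives (hA.baseChange K) hΛK hεK hu h0
  exact exists_pGroup_of_primitives p hA (commute_primitives_of_pow_char p hinj) hinj

/-- If the primitive elements form a torus over `k`, their minimal polynomials are separable, so
over `K` they still act semisimply and none of them is nilpotent. -/
theorem exists_pGroup_of_torus (hA : IsConilpotent k A)
    (hcomm : ∀ u ∈ primitives k A, ∀ v ∈ primitives k A, Commute u v)
    (hss : ∀ u ∈ primitives k A, IsSemisimpleRing (Algebra.adjoin k {u})) :
    ∃ (G : Type) (_ : Group G) (_ : Fintype G), IsPGroup p G ∧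
      ∃ e : K ⊗[k] A ≃ₐ[K] FunctionAlgebra K G, (∀ b, (counit (e b) : K) = counit b) ∧
        ∀ b, (comul (e b) : FunctionAlgebra K G ⊗[K] FunctionAlgebra K G) =
          TensorProduct.map e.toLinearMap e.toLinearMap (comul b) := by
  have hsep : ∀ u ∈ primitives k A, (minpoly k u).Separable := fun u hu =>
    separable_minpoly_of_mem_primitives hu fun x hx h0 => by
      have := hss u hu
      exact congrArg Subtype.val (eq_zero_of_mul_self_eq_zero_of_isSemisimpleRing
        (A := Algebra.adjoin k {u}) (a := ⟨x, hx⟩)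
        (fun a b => Subtype.ext (commute_of_mem_adjoin_singleton a.2 b.2)) (Subtype.ext h0))
  exact exists_pGroup_of_primitives p hA
    (fun u hu v hv => commute_of_mem_baseChange K hcomm (primitives_baseChange_le K hu)
      (primitives_baseChange_le K hv))
    (fun u hu h0 => eq_zero_of_pow_eq_zero_of_mem_baseChange K hcomm hsep
      (primitives_baseChange_le K hu) h0)

end MainEven

/-! ### The parity automorphism and graded products -/

section Parity

open Coalgebra GradedTensorProduct

variable {k A : Type*} [Field k] [Ring A] [Algebra k A] (𝒜 : ZMod 2 → Submodule k A)
  [GradedAlgebra 𝒜]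

/-- The parity automorphism of a superalgebra: `1` on the even part and `-1` on the odd part. -/
noncomputable def parity : A →ₗ[k] A :=
  ((𝒜 0).subtype ∘ₗ DirectSum.component k _ _ 0 - (𝒜 1).subtype ∘ₗ DirectSum.component k _ _ 1) ∘ₗ
    (DirectSum.decomposeLinearEquiv 𝒜).toLinearMap

theorem parity_apply (a : A) :
    parity 𝒜 a = (DirectSum.decompose 𝒜 a 0 : A) - (DirectSum.decompose 𝒜 a 1 : A) := rfl

theorem parity_of_mem_zero {a : A} (ha : a ∈ 𝒜 0) : parity 𝒜 a = a := by
  rw [parity_apply, DirectSum.decompose_of_mem_same 𝒜 ha,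
    DirectSum.decompose_of_mem_ne 𝒜 ha (by decide), sub_zero]

theorem parity_of_mem_one {a : A} (ha : a ∈ 𝒜 1) : parity 𝒜 a = -a := by
  rw [parity_apply, DirectSum.decompose_of_mem_same 𝒜 ha,
    DirectSum.decompose_of_mem_ne 𝒜 ha (by decide), zero_sub]

theorem decompose_zero_add_one (a : A) :
    (DirectSum.decompose 𝒜 a 0 : A) + (DirectSum.decompose 𝒜 a 1 : A) = a := by
  induction a using DirectSum.Decomposition.inductionOn 𝒜 with
  | zero => simp
  | @homogeneous i a =>
    obtain rfl | rfl := (by decide : ∀ i : ZMod 2, i = 0 ∨ i = 1) i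
    · rw [DirectSum.decompose_of_mem_same 𝒜 a.2, DirectSum.decompose_of_mem_ne 𝒜 a.2 (by decide),
        add_zero]
    · rw [DirectSum.decompose_of_mem_same 𝒜 a.2, DirectSum.decompose_of_mem_ne 𝒜 a.2 (by decide),
        zero_add]
  | add a b ha hb =>
    rw [DirectSum.decompose_add, DirectSum.add_apply, DirectSum.add_apply, Submodule.coe_add,
      Submodule.coe_add, add_add_add_comm, ha, hb]

theorem sub_parity (a : A) : a - parity 𝒜 a = (2 : k) • (DirectSum.decompose 𝒜 a 1 : A) := by
  nth_rw 1 [← decompose_zero_add_one 𝒜 a]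
  rw [parity_apply, two_smul]
  abel

theorem eq_zero_of_mem_zero_of_mem_one {a : A} (h0 : a ∈ 𝒜 0) (h1 : a ∈ 𝒜 1) : a = 0 := by
  rw [← DirectSum.decompose_of_mem_same 𝒜 h0, DirectSum.decompose_of_mem_ne 𝒜 h1 (by decide)]

theorem tmul_mul_tmul_of_left_mem_zero {b : A} (hb : b ∈ 𝒜 0) (a c d : A) :
    of k 𝒜 𝒜 (a ⊗ₜ[k] b) * of k 𝒜 𝒜 (c ⊗ₜ[k] d) = of k 𝒜 𝒜 ((a * c) ⊗ₜ[k] (b * d)) := by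
  induction c using DirectSum.Decomposition.inductionOn 𝒜 with
  | zero => simp
  | homogeneous c => exact tmul_zero_coe_mul_coe_tmul 𝒜 𝒜 a ⟨b, hb⟩ c d
  | add c c' h h' =>
    rw [TensorProduct.add_tmul, map_add, mul_add, h, h', mul_add, TensorProduct.add_tmul, map_add]

/-- Moving an odd element past `c` in a graded product applies the parity automorphism to `c`. -/
theorem tmul_mul_tmul_of_left_mem_one {b : A} (hb : b ∈ 𝒜 1) (a c d : A) :
    of k 𝒜 𝒜 (a ⊗ₜ[k] b) * of k 𝒜 𝒜 (c ⊗ₜ[k] d) =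
      of k 𝒜 𝒜 ((a * parity 𝒜 c) ⊗ₜ[k] (b * d)) := by
  induction c using DirectSum.Decomposition.inductionOn 𝒜 with
  | zero => simp
  | @homogeneous i c =>
    have h := tmul_coe_mul_coe_tmul (R := k) 𝒜 𝒜 a (⟨b, hb⟩ : 𝒜 1) c d
    refine h.trans ?_
    fin_cases i
    · have hs : ((-1 : ℤˣ) ^ ((1 : ZMod 2) * 0)) = 1 := by rw [mul_zero, uzpow_zero]
      change ((-1 : ℤˣ) ^ ((1 : ZMod 2) * 0)) • _ = _
      rw [hs, one_smul, parity_of_mem_zero 𝒜 c.2]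
    · have hs : ((-1 : ℤˣ) ^ ((1 : ZMod 2) * 1)) = -1 := by rw [mul_one, uzpow_one]
      change ((-1 : ℤˣ) ^ ((1 : ZMod 2) * 1)) • _ = _
      rw [hs, parity_of_mem_one 𝒜 c.2, mul_neg, TensorProduct.neg_tmul, map_neg, Units.neg_smul,
        one_smul]
  | add c c' h h' =>
    rw [TensorProduct.add_tmul, map_add, mul_add, h, h', map_add, mul_add, TensorProduct.add_tmul,
      map_add]

theorem of_mul_of_mem_tensorSquare {s t : A ⊗[k] A} (hs : s ∈ tensorSquare (𝒜 0))
    (ht : t ∈ tensorSquare (𝒜 0)) :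
    ∃ r ∈ tensorSquare (𝒜 0), of k 𝒜 𝒜 s * of k 𝒜 𝒜 t = of k 𝒜 𝒜 r := by
  have hmul : ∀ {a b : A}, a ∈ 𝒜 0 → b ∈ 𝒜 0 → a * b ∈ 𝒜 0 := fun ha hb => by
    simpa using SetLike.mul_mem_graded ha hb
  refine tensorSquare_induction (motive := fun s => ∃ r ∈ tensorSquare (𝒜 0),
    of k 𝒜 𝒜 s * of k 𝒜 𝒜 t = of k 𝒜 𝒜 r) ⟨0, zero_mem _, by simp⟩ (fun a ha b hb => ?_) ?_ hs
  · refine tensorSquare_induction (motive := fun t => ∃ r ∈ tensorSquare (𝒜 0),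
      of k 𝒜 𝒜 (a ⊗ₜ b) * of k 𝒜 𝒜 t = of k 𝒜 𝒜 r) ⟨0, zero_mem _, by simp⟩
      (fun c hc d hd => ?_) ?_ ht
    · exact ⟨_, tmul_mem_tensorSquare (hmul ha hc) (hmul hb hd),
        tmul_mul_tmul_of_left_mem_zero 𝒜 hb a c d⟩
    · rintro t t' ⟨r, hr, h⟩ ⟨r', hr', h'⟩
      exact ⟨r + r', add_mem hr hr', by rw [map_add, mul_add, h, h', map_add]⟩
  · rintro s s' ⟨r, hr, h⟩ ⟨r', hr', h'⟩
    exact ⟨r + r', add_mem hr hr', by rw [map_add, add_mul, h, h', map_add]⟩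

theorem map_parity_of_mem_superTensorGrading_zero {t : A ⊗[k] A}
    (ht : t ∈ superTensorGrading 𝒜 0) :
    TensorProduct.map (parity 𝒜) (parity 𝒜) t = t := by
  suffices h : superTensorGrading 𝒜 0 ≤ LinearMap.eqLocus
      (TensorProduct.map (parity 𝒜) (parity 𝒜)) LinearMap.id from h ht
  refine iSup_le fun i => ?_
  rintro _ ⟨s, rfl⟩
  induction s with
  | zero => rw [map_zero]; exact zero_mem _
  | add s t hs ht => rw [map_add]; exact add_mem hs ht
  | tmul a b =>
    rw [LinearMap.mem_eqLocus, TensorProduct.map_tmul, TensorProduct.map_tmul, LinearMap.id_apply]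
    obtain ⟨a, ha⟩ := a
    obtain ⟨b, hb⟩ := b
    simp only [Submodule.subtype_apply]
    fin_cases i
    · rw [parity_of_mem_zero 𝒜 ha, parity_of_mem_zero 𝒜 hb]
    · rw [parity_of_mem_one 𝒜 ha, parity_of_mem_one 𝒜 hb, TensorProduct.neg_tmul,
        TensorProduct.tmul_neg, neg_neg]

theorem map_parity_of_mem_superTensorGrading_one {t : A ⊗[k] A}
    (ht : t ∈ superTensorGrading 𝒜 1) :
    TensorProduct.map (parity 𝒜) (parity 𝒜) t = -t := by
  suffices h : superTensorGrading 𝒜 1 ≤ LinearMap.eqLocus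
      (TensorProduct.map (parity 𝒜) (parity 𝒜)) (-LinearMap.id) from h ht
  refine iSup_le fun i => ?_
  rintro _ ⟨s, rfl⟩
  induction s with
  | zero => rw [map_zero]; exact zero_mem _
  | add s t hs ht => rw [map_add]; exact add_mem hs ht
  | tmul a b =>
    rw [LinearMap.mem_eqLocus, TensorProduct.map_tmul, TensorProduct.map_tmul, LinearMap.neg_apply,
      LinearMap.id_apply]
    obtain ⟨a, ha⟩ := a
    obtain ⟨b, hb⟩ := b
    simp only [Submodule.subtype_apply]
    fin_cases i
    · rw [parity_of_mem_zero 𝒜 ha, parity_of_mem_one 𝒜 hb, TensorProduct.tmul_neg]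
    · rw [parity_of_mem_one 𝒜 ha, parity_of_mem_zero 𝒜 hb, TensorProduct.neg_tmul]

end Parity

/-! ### Odd primitive elements -/

section SuperHopf

open Coalgebra GradedTensorProduct Polynomial

variable {k H : Type*} [Field k] [Ring H] [Algebra k H] (𝒜 : ZMod 2 → Submodule k H)
  [GradedAlgebra 𝒜] [Coalgebra k H] [HopfSuperalgebra k 𝒜]

theorem HopfSuperalgebra.isCoaugmented {k H : Type*} [Field k] [Ring H] [Algebra k H]
    (𝒜 : ZMod 2 → Submodule k H) [GradedAlgebra 𝒜] [Coalgebra k H] [HopfSuperalgebra k 𝒜] :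
    IsCoaugmented k H :=
  ⟨HopfSuperalgebra.comul_one 𝒜, HopfSuperalgebra.counit_one 𝒜⟩

theorem comul_parity (a : H) :
    (comul (parity 𝒜 a) : H ⊗[k] H) = TensorProduct.map (parity 𝒜) (parity 𝒜) (comul a) := by
  conv_rhs => rw [← decompose_zero_add_one 𝒜 a]
  rw [map_add, map_add, map_parity_of_mem_superTensorGrading_zero 𝒜
    (HopfSuperalgebra.comul_mem 0 _ (SetLike.coe_mem _)),
    map_parity_of_mem_superTensorGrading_one 𝒜
    (HopfSuperalgebra.comul_mem 1 _ (SetLike.coe_mem _)), parity_apply, map_sub, sub_eq_add_neg]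

theorem reducedComul_parity (a : H) :
    reducedComul k H (parity 𝒜 a) =
      TensorProduct.map (parity 𝒜) (parity 𝒜) (reducedComul k H a) := by
  simp only [reducedComul_apply, comul_parity, map_sub, TensorProduct.map_tmul,
    parity_of_mem_zero 𝒜 (SetLike.one_mem_graded 𝒜)]

theorem primitives_le_of_forall_odd (h2 : (2 : k) ≠ 0)
    (h : ∀ u ∈ primitives k H, u ∈ 𝒜 1 → u = 0) : primitives k H ≤ 𝒜 0 := by
  intro u hu
  have h1 : u - parity 𝒜 u ∈ primitives k H := by
    refine sub_mem hu ?_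
    rw [mem_primitives_iff, reducedComul_parity, mem_primitives_iff.mp hu, map_zero]
  have h3 : u - parity 𝒜 u = 0 := h _ h1 (by
    rw [sub_parity]
    exact (𝒜 1).smul_mem _ (SetLike.coe_mem _))
  rw [sub_parity, smul_eq_zero_iff_right h2] at h3
  rw [← decompose_zero_add_one 𝒜 u, h3, add_zero]
  exact SetLike.coe_mem _

/-- A conilpotent Hopf superalgebra with even primitive elements is purely even. If the `n`-th
filtration step is even, then the reduced comultiplication maps the next one to even tensors, so
it kills odd parts, and these are primitive. -/
theorem isPurelyEven_of_primitives_le (h2 : (2 : k) ≠ 0) (hH : IsConilpotent k H)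
    (h : primitives k H ≤ 𝒜 0) : IsPurelyEven 𝒜 := by
  have := HopfSuperalgebra.isCoaugmented (k := k) 𝒜
  have hF : ∀ n, primFiltration k H n ≤ 𝒜 0 := by
    intro n
    induction n with
    | zero => exact bot_le
    | succ n ih =>
      intro a ha
      have h1 : TensorProduct.map (parity 𝒜) (parity 𝒜) (reducedComul k H a) =
          reducedComul k H a := by
        refine tensorSquare_induction (motive := fun t =>
          TensorProduct.map (parity 𝒜) (parity 𝒜) t = t) (map_zero _) (fun x hx y hy => ?_)
          (fun s t hs ht => by rw [map_add, hs, ht]) (mem_primFiltration_succ.mp ha)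
        rw [TensorProduct.map_tmul, parity_of_mem_zero 𝒜 (ih hx), parity_of_mem_zero 𝒜 (ih hy)]
      have h3 : a - parity 𝒜 a ∈ 𝒜 0 := h (by
        rw [mem_primitives_iff, map_sub, reducedComul_parity, h1, sub_self])
      have h4 := eq_zero_of_mem_zero_of_mem_one 𝒜 h3 (by
        rw [sub_parity]
        exact (𝒜 1).smul_mem _ (SetLike.coe_mem _))
      rw [sub_parity, smul_eq_zero_iff_right h2] at h4
      rw [← decompose_zero_add_one 𝒜 a, h4, add_zero]
      exact SetLike.coe_mem _
  obtain ⟨n, hn⟩ := hH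
  refine eq_top_iff.mpr fun a _ => ?_
  have ha : a = (counit a : k) • (1 : H) + (a - (counit a : k) • (1 : H)) := by abel
  rw [ha]
  exact add_mem ((𝒜 0).smul_mem _ (SetLike.one_mem_graded 𝒜))
    (hF n (hn _ (by simp [counit_one_eq])))

theorem comul_mul_of_odd_primitive {u : H} (hu : u ∈ primitives k H) (hu1 : u ∈ 𝒜 1) (a : H) :
    (comul (u * a) : H ⊗[k] H) =
      TensorProduct.map (LinearMap.mulLeft k u) LinearMap.id (comul a) +
        TensorProduct.map (parity 𝒜) (LinearMap.mulLeft k u) (comul a) := by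
  have key : ∀ t : H ⊗[k] H, of k 𝒜 𝒜 (1 ⊗ₜ u + u ⊗ₜ 1) * of k 𝒜 𝒜 t = of k 𝒜 𝒜
      (TensorProduct.map (LinearMap.mulLeft k u) LinearMap.id t +
        TensorProduct.map (parity 𝒜) (LinearMap.mulLeft k u) t) := by
    intro t
    induction t with
    | zero => simp
    | tmul x y =>
      rw [map_add, add_mul, tmul_mul_tmul_of_left_mem_one 𝒜 hu1,
        tmul_mul_tmul_of_left_mem_zero 𝒜 (SetLike.one_mem_graded 𝒜), one_mul, one_mul,
        TensorProduct.map_tmul, TensorProduct.map_tmul, map_add, add_comm]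
      rfl
    | add s t hs ht =>
      rw [map_add (of k 𝒜 𝒜) s, mul_add, hs, ht, ← map_add, map_add (TensorProduct.map _ _) s,
        map_add (TensorProduct.map _ _) s, add_add_add_comm]
  refine (of k 𝒜 𝒜).injective ?_
  rw [HopfSuperalgebra.comul_mul, comul_of_mem_primitives hu, key]

theorem comul_mul_mem_tensorSquare {a b : H} (ha : (comul a : H ⊗[k] H) ∈ tensorSquare (𝒜 0))
    (hb : (comul b : H ⊗[k] H) ∈ tensorSquare (𝒜 0)) :
    (comul (a * b) : H ⊗[k] H) ∈ tensorSquare (𝒜 0) := by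
  obtain ⟨r, hr, h⟩ := of_mul_of_mem_tensorSquare 𝒜 ha hb
  rw [← HopfSuperalgebra.comul_mul] at h
  rwa [(of k 𝒜 𝒜).injective h]

theorem comul_mem_tensorSquare_of_mem_adjoin {w : H} (hw : w ∈ primitives k H) (hw0 : w ∈ 𝒜 0)
    {a : H} (ha : a ∈ Algebra.adjoin k {w}) : (comul a : H ⊗[k] H) ∈ tensorSquare (𝒜 0) := by
  have h1 : (1 : H) ∈ 𝒜 0 := SetLike.one_mem_graded 𝒜
  induction ha using Algebra.adjoin_induction with
  | mem x hx =>
    rw [Set.mem_singleton_iff.mp hx, comul_of_mem_primitives hw]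
    exact add_mem (tmul_mem_tensorSquare h1 hw0) (tmul_mem_tensorSquare hw0 h1)
  | algebraMap r =>
    rw [Algebra.algebraMap_eq_smul_one, map_smul, HopfSuperalgebra.comul_one 𝒜]
    exact Submodule.smul_mem _ _ (tmul_mem_tensorSquare h1 h1)
  | add x y _ _ hx hy => rw [map_add]; exact add_mem hx hy
  | mul x y _ _ hx hy => exact comul_mul_mem_tensorSquare 𝒜 hx hy

/-- In `0 = Δ(E u) = ∑ E₁ u ⊗ E₂ + E₁ ⊗ E₂ u` both summands vanish, by parity. Hence
`0 = ∑ S(E₁) E₂ u = ε(E) u`. -/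
theorem eq_zero_of_mul_odd_primitive_eq_zero (h2 : (2 : k) ≠ 0) {u E : H}
    (hu : u ∈ primitives k H) (hu1 : u ∈ 𝒜 1) (hE : (comul E : H ⊗[k] H) ∈ tensorSquare (𝒜 0))
    (hεE : (counit E : k) ≠ 0) (hEu : E * u = 0) : u = 0 := by
  let R : H →ₗ[k] H := LinearMap.mulRight k u
  have key : ∀ t ∈ tensorSquare (𝒜 0), of k 𝒜 𝒜 t * of k 𝒜 𝒜 (1 ⊗ₜ u + u ⊗ₜ 1) = of k 𝒜 𝒜
      (TensorProduct.map LinearMap.id R t + TensorProduct.map R LinearMap.id t) := by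
    intro t ht
    refine tensorSquare_induction (motive := fun t => of k 𝒜 𝒜 t * of k 𝒜 𝒜 (1 ⊗ₜ u + u ⊗ₜ 1) =
      of k 𝒜 𝒜 (TensorProduct.map LinearMap.id R t + TensorProduct.map R LinearMap.id t))
      (by simp) (fun a ha b hb => ?_) (fun s t hs ht => ?_) ht
    · rw [map_add, mul_add, tmul_mul_tmul_of_left_mem_zero 𝒜 hb,
        tmul_mul_tmul_of_left_mem_zero 𝒜 hb, mul_one, mul_one, ← map_add]
      rfl
    · rw [map_add (of k 𝒜 𝒜) s, add_mul, hs, ht, ← map_add, map_add (TensorProduct.map _ _) s,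
        map_add (TensorProduct.map _ _) s, add_add_add_comm]
  have h0 : TensorProduct.map LinearMap.id R (comul E) +
      TensorProduct.map R LinearMap.id (comul E) = 0 := by
    refine (of k 𝒜 𝒜).injective ?_
    rw [← key _ hE, ← comul_of_mem_primitives hu, ← HopfSuperalgebra.comul_mul, hEu, map_zero,
      map_zero]
  -- the parity of the first tensor factor separates the two summands
  have hl : TensorProduct.map (parity 𝒜) LinearMap.id
      (TensorProduct.map LinearMap.id R (comul E)) = TensorProduct.map LinearMap.id R (comul E) := by
    refine tensorSquare_induction (motive := fun t => TensorProduct.map (parity 𝒜) LinearMap.id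
      (TensorProduct.map LinearMap.id R t) = TensorProduct.map LinearMap.id R t)
      (by simp) (fun a ha b _ => ?_) (fun s t hs ht => by rw [map_add, map_add, hs, ht]) hE
    rw [TensorProduct.map_tmul, TensorProduct.map_tmul, LinearMap.id_apply,
      parity_of_mem_zero 𝒜 ha, LinearMap.id_apply]
  have hr : TensorProduct.map (parity 𝒜) LinearMap.id
      (TensorProduct.map R LinearMap.id (comul E)) =
        -TensorProduct.map R LinearMap.id (comul E) := by
    refine tensorSquare_induction (motive := fun t => TensorProduct.map (parity 𝒜) LinearMap.id
      (TensorProduct.map R LinearMap.id t) = -TensorProduct.map R LinearMap.id t)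
      (by simp) (fun a ha b _ => ?_)
      (fun s t hs ht => by rw [map_add, map_add, hs, ht, neg_add]) hE
    have : R a ∈ 𝒜 1 := by
      have h := SetLike.mul_mem_graded ha hu1
      rwa [zero_add] at h
    rw [TensorProduct.map_tmul, TensorProduct.map_tmul, LinearMap.id_apply,
      parity_of_mem_one 𝒜 this, LinearMap.id_apply, TensorProduct.neg_tmul]
  have h3 : TensorProduct.map LinearMap.id R (comul E : H ⊗[k] H) = 0 := by
    have h4 := congrArg (TensorProduct.map (parity 𝒜) LinearMap.id) h0
    rw [map_add, hl, hr, map_zero, ← sub_eq_add_neg, sub_eq_zero] at h4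
    rw [← h4, ← two_smul k, smul_eq_zero_iff_right h2] at h0
    exact h0
  -- multiply `∑ E₁ ⊗ E₂ u = 0` out with the antipode in the first factor
  have h5 : ∀ t : H ⊗[k] H, LinearMap.mul' k H ((HopfSuperalgebra.antipode 𝒜).rTensor H
      (TensorProduct.map LinearMap.id R t)) =
        LinearMap.mul' k H ((HopfSuperalgebra.antipode 𝒜).rTensor H t) * u := by
    intro t
    induction t with
    | zero => simp
    | tmul x y =>
      rw [TensorProduct.map_tmul, LinearMap.rTensor_tmul, LinearMap.rTensor_tmul,
        LinearMap.mul'_apply, LinearMap.mul'_apply, mul_assoc]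
      rfl
    | add s t hs ht => simp only [map_add, add_mul, hs, ht]
  have h6 := LinearMap.congr_fun (HopfSuperalgebra.mul_antipode_rTensor_comul (𝒜 := 𝒜)) E
  have h7 := h5 (comul E)
  simp only [LinearMap.comp_apply, Algebra.linearMap_apply] at h6
  rw [h3, map_zero, map_zero, h6, ← Algebra.smul_def] at h7
  exact (smul_eq_zero_iff_right hεE).mp h7.symm

/-- A conilpotent Hopf superalgebra with a normalized left integral has no nonzero odd primitive
elements. The square `w` of an odd primitive element `u` is an even primitive element. If `X g` is
the minimal polynomial of `w`, then `w g(w) = u (u g(w)) = 0`, so `E = g(w)` satisfies `u E = 0` by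
`mul_eq_zero_of_mul_mul_eq_zero`; the same lemma shows `ε(E) = g(0) ≠ 0`, as otherwise the minimal
polynomial could be shortened. -/
theorem eq_zero_of_odd_primitive [FiniteDimensional k H] (h2 : (2 : k) ≠ 0)
    (hH : IsConilpotent k H) {Λ : H} (hΛ : ∀ a, a * Λ = (counit a : k) • Λ)
    (hεΛ : (counit Λ : k) = 1) {u : H} (hu : u ∈ primitives k H) (hu1 : u ∈ 𝒜 1) : u = 0 := by
  have := HopfSuperalgebra.isCoaugmented (k := k) 𝒜
  have h1 : (1 : H) ∈ 𝒜 0 := SetLike.one_mem_graded 𝒜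
  have hεu := counit_eq_zero_of_mem_primitives hu
  have hcancel : ∀ q : H, Commute u q → u * (u * q) = 0 → u * q = 0 := fun q hq hq2 =>
    mul_eq_zero_of_mul_mul_eq_zero hH (parity 𝒜) (parity_of_mem_zero 𝒜 h1)
      (comul_mul_of_odd_primitive 𝒜 hu hu1)
      (fun a => by rw [HopfSuperalgebra.counit_mul 𝒜, hεu, zero_mul])
      (by rw [hΛ, hεu, zero_smul]) (by rw [hεΛ]; exact one_ne_zero) hq hq2
  set w := u * u with hw
  have hwP : w ∈ primitives k H := by
    change (comul w : H ⊗[k] H) = _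
    rw [hw, comul_mul_of_odd_primitive 𝒜 hu hu1, comul_of_mem_primitives hu]
    simp only [map_add, TensorProduct.map_tmul, LinearMap.mulLeft_apply, LinearMap.id_apply,
      parity_of_mem_zero 𝒜 h1, parity_of_mem_one 𝒜 hu1, mul_one, TensorProduct.neg_tmul]
    abel
  have hw0 : w ∈ 𝒜 0 := by
    have := SetLike.mul_mem_graded hu1 hu1
    rwa [show (1 : ZMod 2) + 1 = 0 from rfl] at this
  have hint : IsIntegral k w := Algebra.IsIntegral.isIntegral w
  have hε : ∀ q : k[X], (counit (aeval w q) : k) = q.eval 0 := by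
    let εA : H →ₐ[k] k := AlgHom.ofLinearMap counit (counit_one_eq k)
      (HopfSuperalgebra.counit_mul 𝒜)
    intro q
    have h := aeval_algHom_apply εA w q
    have hw0 : εA w = 0 := counit_eq_zero_of_mem_primitives hwP
    rw [hw0, coe_aeval_eq_eval] at h
    exact h.symm
  have hcomm : ∀ q : k[X], Commute u (aeval w q) := fun q =>
    (Algebra.commute_of_mem_adjoin_singleton_of_commute (aeval_mem_adjoin_singleton k w)
      ((Commute.refl u).mul_right (Commute.refl u)))
  obtain ⟨g, hg⟩ : X ∣ minpoly k w := by
    rw [X_dvd_iff, coeff_zero_eq_eval_zero, ← hε, minpoly.aeval, map_zero]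
  have hwg : w * aeval w g = 0 := by
    have := minpoly.aeval k w
    rwa [hg, map_mul, aeval_X] at this
  have hg0 : g.eval 0 ≠ 0 := by
    intro h0
    obtain ⟨h, rfl⟩ : X ∣ g := by rwa [X_dvd_iff, coeff_zero_eq_eval_zero]
    have hz : aeval w (X * h) = 0 := by
      have hassoc : ∀ x, w * x = u * (u * x) := mul_assoc u u
      have hu' := Commute.refl u
      rw [map_mul, aeval_X, hassoc] at hwg ⊢
      rw [hassoc] at hwg
      exact hcancel _ (hu'.mul_right (hcomm h))
        (hcancel _ (hu'.mul_right (hu'.mul_right (hcomm h))) hwg)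
    have hne : X * h ≠ 0 := fun h0 => minpoly.ne_zero hint (by rw [hg, h0, mul_zero])
    have := natDegree_minpoly_le hne hz
    rw [hg, natDegree_X_mul hne] at this
    omega
  have huE : u * aeval w g = 0 := hcancel _ (hcomm g) (by rw [← mul_assoc, hwg])
  exact eq_zero_of_mul_odd_primitive_eq_zero 𝒜 h2 hu hu1
    (comul_mem_tensorSquare_of_mem_adjoin 𝒜 hwP hw0 (aeval_mem_adjoin_singleton k w))
    (by rwa [hε]) (by rw [← (hcomm g).eq, huE])

end SuperHopf

/-! ### Purely even Hopf superalgebras -/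

section Even

open Coalgebra GradedTensorProduct

variable {k H : Type*} [Field k] [Ring H] [Algebra k H] (𝒜 : ZMod 2 → Submodule k H)
  [GradedAlgebra 𝒜]

theorem IsPurelyEven.comul_mul [Coalgebra k H] [HopfSuperalgebra k 𝒜] (h : IsPurelyEven 𝒜)
    (a b : H) : (comul (a * b) : H ⊗[k] H) = comul a * comul b := by
  have hmem : ∀ a : H, a ∈ 𝒜 0 := fun a => h ▸ Submodule.mem_top
  have hmul : ∀ s t : H ⊗[k] H, of k 𝒜 𝒜 s * of k 𝒜 𝒜 t = of k 𝒜 𝒜 (s * t) := by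
    intro s t
    induction s with
    | zero => simp
    | add s s' hs hs' => rw [map_add, add_mul, hs, hs', add_mul, map_add]
    | tmul a b =>
      induction t with
      | zero => simp
      | add t t' ht ht' => rw [map_add, mul_add, ht, ht', mul_add, map_add]
      | tmul c d =>
        rw [tmul_mul_tmul_of_left_mem_zero 𝒜 (hmem b), Algebra.TensorProduct.tmul_mul_tmul]
  exact (of k 𝒜 𝒜).injective (by rw [HopfSuperalgebra.comul_mul, hmul])

/-- A purely even Hopf superalgebra is an ordinary bialgebra, as the signs disappear. -/
abbrev IsPurelyEven.bialgebra [Coalgebra k H] [HopfSuperalgebra k 𝒜] (h : IsPurelyEven 𝒜) :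
    Bialgebra k H :=
  Bialgebra.mk' k H (HopfSuperalgebra.counit_one 𝒜)
    (fun {a b} => HopfSuperalgebra.counit_mul 𝒜 a b) (HopfSuperalgebra.comul_one 𝒜)
    (fun {a b} => h.comul_mul 𝒜 a b)

theorem superCommutator_of_mem_zero {u v : H} (hu : u ∈ 𝒜 0) (hv : v ∈ 𝒜 0) :
    superCommutator 𝒜 u v = u * v - v * u := by
  have h0 : ∀ {a : H}, a ∈ 𝒜 0 → ∀ i : ZMod 2, i ≠ 0 → (DirectSum.decompose 𝒜 a i : H) = 0 :=
    fun ha i hi => DirectSum.decompose_of_mem_ne 𝒜 ha hi.symm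
  rw [superCommutator, Finset.sum_eq_single 0, Finset.sum_eq_single 0, mul_zero, uzpow_zero,
    one_smul, DirectSum.decompose_of_mem_same 𝒜 hu, DirectSum.decompose_of_mem_same 𝒜 hv]
  · intro j _ hj
    simp only [h0 hv j hj, mul_zero, zero_mul, smul_zero, sub_zero]
  · simp
  · intro i _ hi
    refine Finset.sum_eq_zero fun j _ => ?_
    simp only [h0 hu i hi, mul_zero, zero_mul, smul_zero, sub_zero]
  · simp

variable (K G : Type*) [Field K] [Algebra k K] [Group G] [Fintype G]

/-- An isomorphism with a function algebra respects the gradings if both sides are purely even. -/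
theorem nonempty_hopfSuperalgebraEquiv [Coalgebra K (K ⊗[k] H)] (h : IsPurelyEven 𝒜)
    (e : K ⊗[k] H ≃ₐ[K] FunctionAlgebra K G) (hε : ∀ b, (counit (e b) : K) = counit b)
    (hΔ : ∀ b, (comul (e b) : FunctionAlgebra K G ⊗[K] FunctionAlgebra K G) =
      TensorProduct.map e.toLinearMap e.toLinearMap (comul b)) :
    Nonempty (HopfSuperalgebraEquiv (baseChangeGrading K 𝒜) (FunctionAlgebra.grading K G)) := by
  refine ⟨{ e with map_mem := fun i a ha => ?_, map_counit := hε, map_comul := hΔ }⟩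
  obtain rfl | rfl := (by decide : ∀ i : ZMod 2, i = 0 ∨ i = 1) i
  · rw [FunctionAlgebra.grading, if_pos rfl]
    exact Submodule.mem_top
  · have h1 : 𝒜 1 = ⊥ := eq_bot_iff.mpr fun x hx =>
      eq_zero_of_mem_zero_of_mem_one 𝒜 (h ▸ Submodule.mem_top) hx
    rw [baseChangeGrading, h1, Submodule.baseChange_bot, Submodule.mem_bot] at ha
    rw [ha]
    change e 0 ∈ _
    rw [map_zero]
    exact zero_mem _

variable {K G}

/-- Being purely even, commutative and semisimple descends along `k → K`. -/
theorem isPurelyEven_and_commute_and_isSemisimpleRing [FiniteDimensional k H]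
    [Coalgebra K (K ⊗[k] H)]
    (e : HopfSuperalgebraEquiv (baseChangeGrading K 𝒜) (FunctionAlgebra.grading K G)) :
    IsPurelyEven 𝒜 ∧ (∀ a b : H, a * b = b * a) ∧ IsSemisimpleRing H := by
  let φ : H →+* FunctionAlgebra K G := (e.toAlgEquiv : K ⊗[k] H →+* FunctionAlgebra K G).comp
    (Algebra.TensorProduct.includeRight : H →ₐ[k] K ⊗[k] H).toRingHom
  have hφ : Function.Injective φ := e.toAlgEquiv.injective.comp
    (Algebra.TensorProduct.includeRight_injective (FaithfulSMul.algebraMap_injective k K))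
  have hcomm : ∀ a b : H, a * b = b * a := fun a b => hφ (by
    rw [map_mul, map_mul, mul_comm])
  refine ⟨eq_top_iff.mpr fun a _ => ?_, hcomm,
    isSemisimpleRing_of_commute_of_isReduced (k := k) hcomm fun a ha => hφ ?_⟩
  · have h1 : (DirectSum.decompose 𝒜 a 1 : H) = 0 := hφ (by
      have h2 : φ (DirectSum.decompose 𝒜 a 1) ∈ FunctionAlgebra.grading K G 1 :=
        e.map_mem 1 _ (Submodule.tmul_mem_baseChange_of_mem 1 (SetLike.coe_mem _))
      rw [FunctionAlgebra.grading, if_neg one_ne_zero, Submodule.mem_bot] at h2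
      rw [h2, map_zero])
    rw [← decompose_zero_add_one 𝒜 a, h1, add_zero]
    exact SetLike.coe_mem _
  · have h0 : φ a * φ a = 0 := by rw [← map_mul, ha, map_zero]
    rw [map_zero]
    exact funext fun g => mul_self_eq_zero.mp (congrFun h0 g)

theorem primitivesIsTorus_of_commute [FiniteDimensional k H] [Coalgebra k H]
    (h : IsPurelyEven 𝒜) (hcomm : ∀ a b : H, a * b = b * a) [IsSemisimpleRing H] :
    PrimitivesIsTorus 𝒜 := by
  refine ⟨fun u _ v _ => ?_, fun u _ => isSemisimpleRing_of_commute_of_isReduced (k := k)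
    (fun a b => Subtype.ext (hcomm a b)) fun a ha => Subtype.ext
      (eq_zero_of_mul_self_eq_zero_of_isSemisimpleRing hcomm (congrArg Subtype.val ha))⟩
  rw [superCommutator_of_mem_zero 𝒜 (h ▸ Submodule.mem_top) (h ▸ Submodule.mem_top), hcomm,
    sub_self]

end Even

theorem corollary7p2 {k H : Type*} [Field k] (p : ℕ) [CharP k p] (hp : 2 < p)
    [Ring H] [Algebra k H] [FiniteDimensional k H]
    (𝒜 : ZMod 2 → Submodule k H) [GradedAlgebra 𝒜] [Coalgebra k H] [HopfSuperalgebra k 𝒜]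
    (hirr : IsIrreducibleHopf k H) :
    List.TFAE [
      IsSemisimpleRing H,
      IsPurelyEven 𝒜 ∧ (∀ a b : H, a * b = b * a) ∧ IsSemisimpleRing H,
      ∃ (G : Type) (_ : Group G) (_ : Fintype G), IsPGroup p G ∧
        Nonempty (HopfSuperalgebraEquiv (baseChangeGrading (AlgebraicClosure k) 𝒜)
          (FunctionAlgebra.grading (AlgebraicClosure k) G)),
      primitives k H ≤ 𝒜 0 ∧ PrimitivesIsTorus 𝒜] := by
  have := HopfSuperalgebra.isCoaugmented (k := k) 𝒜
  have hH : IsConilpotent k H := hirr.isConilpotent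
  have : Fact p.Prime := ⟨(CharP.char_is_prime_or_zero k p).resolve_right (by omega)⟩
  have : CharP (AlgebraicClosure k) p :=
    charP_of_injective_algebraMap (FaithfulSMul.algebraMap_injective k (AlgebraicClosure k)) p
  have h2 : (2 : k) ≠ 0 := fun h => by
    have h' : ((2 : ℕ) : k) = 0 := by exact_mod_cast h
    exact absurd (Nat.le_of_dvd two_pos ((CharP.cast_eq_zero_iff k p 2).mp h')) (by omega)
  tfae_have 1 → 3 := fun hss => by
    obtain ⟨Λ, hΛ, hε⟩ := exists_integral (k := k) (HopfSuperalgebra.counit_mul 𝒜)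
    have heven := isPurelyEven_of_primitives_le 𝒜 h2 hH (primitives_le_of_forall_odd 𝒜 h2
      fun u hu hu1 => eq_zero_of_odd_primitive 𝒜 h2 hH hΛ hε hu hu1)
    let := heven.bialgebra
    obtain ⟨G, hG, hG', hpG, e, he, he'⟩ :=
      exists_pGroup_of_integral (K := AlgebraicClosure k) p hH hΛ hε
    exact ⟨G, hG, hG', hpG, nonempty_hopfSuperalgebraEquiv 𝒜 _ G heven e he he'⟩
  tfae_have 4 → 3 := fun ⟨hle, hcomm, hss⟩ => by
    have heven := isPurelyEven_of_primitives_le 𝒜 h2 hH hle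
    let := heven.bialgebra
    obtain ⟨G, hG, hG', hpG, e, he, he'⟩ :=
      exists_pGroup_of_torus (K := AlgebraicClosure k) p hH (fun u hu v hv => by
        have := hcomm u hu v hv
        rwa [superCommutator_of_mem_zero 𝒜 (hle hu) (hle hv), sub_eq_zero] at this) hss
    exact ⟨G, hG, hG', hpG, nonempty_hopfSuperalgebraEquiv 𝒜 _ G heven e he he'⟩
  tfae_have 3 → 2 := fun ⟨G, _, _, _, ⟨e⟩⟩ =>
    isPurelyEven_and_commute_and_isSemisimpleRing 𝒜 e
  tfae_have 2 → 1 := fun h => h.2.2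
  tfae_have 2 → 4 := fun ⟨heven, hcomm, hss⟩ =>
    ⟨fun u _ => heven ▸ Submodule.mem_top, primitivesIsTorus_of_commute 𝒜 heven hcomm⟩
  tfae_finish
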